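/- Let $n\ge 2$ and $R>0$, let $B_R=\{x\in\mathbb{R}^n : |x|<R\}$, and for $m\ge 1$ let $j_{\frac{n-2}{2},m}$ denote the $m$-th positive zero of the Bessel function $J_{\frac{n-2}{2}}$. (a) A number $k>0$ has the form $k=j_{\frac{n-2}{2},m}/R$ for some $m\ge 1$ if and only if $k^2$ is a Dirichlet eigenvalue of $-\Delta$ in $B_R$ with a radial eigenfunction, i.e. there is a radial function $w\in H^1_0(B_R)$, $w\not\equiv 0$, with $-\Delta w=k^2w$ weakly in $B_R$. (b) Let $m\ge1$ and $k=j_{\frac{n-2}{2},m}/R$ (so $k>0$). If $u_0$ is a real-valued solution of $(\Delta+k^2)u_0=0$ in $\mathbb{R}^n$, then either $u_0$ vanishes identically on $\partial B_R$, or $u_0$ changes sign on $\partial B_R$, i.e. it takes both positive and negative values there. (c) Consequently, for such $k$ there is no Herglotz wave $u_0(x)=\int_{S^{n-1}}e^{ikx\cdot\omega}f(\omega)\,d\omega$, $f\in C^\infty(S^{n-1})$ (complex-valued), with $u_0|_{\partial B_R}>0$. This is the sense in which, for balls $D=B_R$, one cannot drop the hypothesis that $k^2$ is not a Dirichlet eigenvalue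 from the theorem: if $D\subset\mathbb{R}^n$ is a bounded Lipschitz domain with $\mathbb{R}^n\setminus\overline{D}$ connected and $k>0$ is such that $k^2$ is not a Dirichlet eigenvalue of $-\Delta$ in $D$, then there is a Herglotz wave $u_0$ as above with $u_0|_{\partial D}>0$. -/

import Mathlib

open MeasureTheory Filter Topology Metric
open scoped ContDiff Laplacian Gradient ENNReal

noncomputable section

/-- The Bessel function of the first kind `J_ν(x)`, given by its power series (used here for
`ν ≥ 0` and `x > 0`). -/
def besselJ (ν x : ℝ) : ℝ :=
  ∑' j : ℕ, (-1 : ℝ) ^ j / ((j.factorial : ℝ) * Real.Gamma ((j : ℝ) + ν + 1)) *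
    (x / 2) ^ (2 * (j : ℝ) + ν)

/-- For `m ≥ 1`, the `m`-th positive zero `j_{ν,m}` of `J_ν`: starting from the auxiliary value
`j_{ν,0} = 0`, each term is the smallest zero of `J_ν` exceeding the previous one. -/
def besselJZero (ν : ℝ) : ℕ → ℝ
  | 0 => 0
  | m + 1 => sInf {x : ℝ | besselJZero ν m < x ∧ besselJ ν x = 0}

/-- Test functions: real-valued `φ ∈ C_c^∞(D)`. -/
def IsTestFunctionOn {n : ℕ} (D : Set (EuclideanSpace ℝ (Fin n)))
    (φ : EuclideanSpace ℝ (Fin n) → ℝ) : Prop :=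
  ContDiff ℝ ∞ φ ∧ HasCompactSupport φ ∧ tsupport φ ⊆ D

/-- `u ∈ H^1_0(D)` with weak gradient `g`: the pair `(u, g)` is an `L²(D)`-limit of pairs
`(φ_j, ∇ φ_j)` with `φ_j ∈ C_c^∞(D)`, i.e. `H^1_0(D)` is the closure of `C_c^∞(D)` in `H^1(D)`. -/
def HasH10GradientOn {n : ℕ} (D : Set (EuclideanSpace ℝ (Fin n)))
    (u : EuclideanSpace ℝ (Fin n) → ℝ)
    (g : EuclideanSpace ℝ (Fin n) → EuclideanSpace ℝ (Fin n)) : Prop :=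
  MemLp u 2 (volume.restrict D) ∧ MemLp g 2 (volume.restrict D) ∧
  ∃ φ : ℕ → EuclideanSpace ℝ (Fin n) → ℝ,
    (∀ j, IsTestFunctionOn D (φ j)) ∧
    Tendsto (fun j => eLpNorm (fun x => φ j x - u x) 2 (volume.restrict D)) atTop (𝓝 0) ∧
    Tendsto (fun j => eLpNorm (fun x => ∇ (φ j) x - g x) 2 (volume.restrict D)) atTop (𝓝 0)

/-- `u` is a Dirichlet eigenfunction of `-Δ` in `D` with eigenvalue `μ`: `u ∈ H^1_0(D)`, `u` is not
a.e. zero in `D`, and `-Δ u = μ u` weakly in `D`. -/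
def IsDirichletEigenfunction {n : ℕ} (D : Set (EuclideanSpace ℝ (Fin n))) (μ : ℝ)
    (u : EuclideanSpace ℝ (Fin n) → ℝ) : Prop :=
  ¬ (∀ᵐ x ∂(volume.restrict D), u x = 0) ∧
  ∃ g : EuclideanSpace ℝ (Fin n) → EuclideanSpace ℝ (Fin n),
    HasH10GradientOn D u g ∧
    ∀ φ : EuclideanSpace ℝ (Fin n) → ℝ, IsTestFunctionOn D φ →
      ∫ x in D, inner ℝ (g x) (∇ φ x) = μ * ∫ x in D, u x * φ x

/-- `u` is (a.e. in `D` equal to) a function of `|x|`. -/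
def IsRadialOn {n : ℕ} (D : Set (EuclideanSpace ℝ (Fin n)))
    (u : EuclideanSpace ℝ (Fin n) → ℝ) : Prop :=
  ∃ h : ℝ → ℝ, Measurable h ∧ ∀ᵐ x ∂(volume.restrict D), u x = h ‖x‖

/-- Classical real solutions of the Helmholtz equation `(Δ + k²) u = 0` in `ℝⁿ`. -/
def IsHelmholtzSolution {n : ℕ} (k : ℝ) (u : EuclideanSpace ℝ (Fin n) → ℝ) : Prop :=
  ContDiff ℝ 2 u ∧ ∀ x, Δ u x + k ^ 2 * u x = 0

/-- Herglotz waves `u(x) = ∫_{S^{n-1}} e^{i k x·z} f(z) dz` with `f ∈ C^∞(S^{n-1})`; smooth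
functions on the sphere are the restrictions of smooth functions on `ℝⁿ`. -/
def IsHerglotzWave {n : ℕ} (k : ℝ) (u : EuclideanSpace ℝ (Fin n) → ℂ) : Prop :=
  ∃ f : EuclideanSpace ℝ (Fin n) → ℂ, ContDiff ℝ ∞ f ∧
    ∀ x, u x = ∫ z : sphere (0 : EuclideanSpace ℝ (Fin n)) 1,
      Complex.exp (Complex.I * ((k * inner ℝ x (z : EuclideanSpace ℝ (Fin n)) : ℝ) : ℂ)) *
        f z ∂(volume : Measure (EuclideanSpace ℝ (Fin n))).toSphere

end

/-! Write `A_ν = besselEntire ν`, so that for `x > 0` the zeros of `J_ν` are those of the smooth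
function `A_ν(x²)`. With `ν = (n-2)/2`, `ψ(x) = A_ν(k²|x|²)` is the smooth radial solution of `Δψ +
k²ψ = 0`, and `k = j_{ν,m}/R` says that `ψ` vanishes on the sphere of radius `R`.

Such a `ψ` is a radial Dirichlet eigenfunction. Conversely, suppose `ψ ≠ 0` on the sphere and `w` is
a radial eigenfunction. Any smooth `f` that is constant on the sphere can be corrected by a multiple
of `ψ` to vanish there, so testing gives `∫ w (Δf + k² f) = 0`. Taking `f = |x|^(2j)` kills all even
radial moments of `w`, and Weierstrass approximation gives `w = 0`
(`besselEntire_eq_zero_of_radial_eigenfunction`).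

For a Helmholtz solution `u`, Green's second identity says that the flux of `ψ∇u - u∇ψ` through the
sphere is zero. When `ψ = 0` there, its radial derivative is constant, and nonzero because positive
zeros are simple (`besselEntire_succ_ne_zero`). Hence `u` has mean zero on the sphere
(`integral_sphere_eq_zero_of_helmholtz`), which forces the dichotomy. Plane waves then have mean
zero, and by Fubini so do Herglotz waves.

Since `besselJZero` is defined by successive infima, identifying its values with all positive zeros
also needs isolated zeros and arbitrarily large ones; the latter follow from a Sturm comparison
(`not_besselEntire_sq_constant_sign`). -/

/-! ### The Bessel power series: derivative and recurrence -/

/-- The entire function `t ↦ ∑ (-1)^j / (j! Γ(j+ν+1)) (t/4)^j`, so that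
`J_ν(x) = (x/2)^ν * besselEntire ν (x^2)`. -/
noncomputable def besselEntire (ν t : ℝ) : ℝ :=
  ∑' j : ℕ, (-1 : ℝ) ^ j / ((j.factorial : ℝ) * Real.Gamma ((j : ℝ) + ν + 1)) * (t / 4) ^ j

theorem gamma_le_gamma_nat_add {ν : ℝ} (hν : 0 ≤ ν) (j : ℕ) :
    Real.Gamma (ν + 1) ≤ Real.Gamma (j + ν + 1) := by
  induction j with
  | zero => simp
  | succ j ih =>
    have h : (0 : ℝ) < j + ν + 1 := by positivity
    have h1 : ((j + 1 : ℕ) : ℝ) + ν + 1 = (j + ν + 1) + 1 := by push_cast; ring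
    rw [h1, Real.Gamma_add_one h.ne']
    have hG := Real.Gamma_pos_of_pos h
    have : (1 : ℝ) ≤ j + ν + 1 := by linarith [Nat.cast_nonneg (α := ℝ) j]
    nlinarith

theorem abs_besselEntire_coeff_le {ν : ℝ} (hν : 0 ≤ ν) (j : ℕ) :
    |(-1 : ℝ) ^ j / ((j.factorial : ℝ) * Real.Gamma ((j : ℝ) + ν + 1))| ≤
      (Real.Gamma (ν + 1))⁻¹ * ((j.factorial : ℝ))⁻¹ := by
  have h0 : 0 < Real.Gamma (ν + 1) := Real.Gamma_pos_of_pos (by linarith)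
  have h1 := gamma_le_gamma_nat_add hν j
  have hf : (0 : ℝ) < j.factorial := by positivity
  rw [abs_div, abs_pow, abs_neg, abs_one, one_pow, abs_of_pos (mul_pos hf (h0.trans_le h1)),
    ← mul_inv, ← one_div, mul_comm (Real.Gamma (ν + 1))]
  exact one_div_le_one_div_of_le (mul_pos hf h0) (by gcongr)

theorem summable_besselEntire {ν : ℝ} (hν : 0 ≤ ν) (t : ℝ) :
    Summable fun j : ℕ =>
      (-1 : ℝ) ^ j / ((j.factorial : ℝ) * Real.Gamma ((j : ℝ) + ν + 1)) * (t / 4) ^ j := by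
  refine Summable.of_norm_bounded
    (g := fun j : ℕ => (Real.Gamma (ν + 1))⁻¹ * (|t / 4| ^ j / j.factorial))
    ((Real.summable_pow_div_factorial _).mul_left _) fun j => ?_
  rw [norm_mul, Real.norm_eq_abs, norm_pow, Real.norm_eq_abs]
  calc _ ≤ (Real.Gamma (ν + 1))⁻¹ * ((j.factorial : ℝ))⁻¹ * |t / 4| ^ j := by
        gcongr; exact abs_besselEntire_coeff_le hν j
    _ = _ := by ring

theorem besselEntire_coeff_succ {ν : ℝ} (j : ℕ) :
    (-1 : ℝ) ^ (j + 1) / (((j + 1).factorial : ℝ) * Real.Gamma (((j + 1 : ℕ) : ℝ) + ν + 1)) *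
      ((j + 1 : ℕ) : ℝ) =
    -((-1 : ℝ) ^ j / ((j.factorial : ℝ) * Real.Gamma ((j : ℝ) + (ν + 1) + 1))) := by
  have h1 : (((j + 1 : ℕ) : ℝ) + ν + 1) = (j : ℝ) + (ν + 1) + 1 := by push_cast; ring
  have h2 : ((j + 1 : ℕ) : ℝ) ≠ 0 := by positivity
  have hf : (j.factorial : ℝ) ≠ 0 := by positivity
  rw [h1, Nat.factorial_succ, pow_succ]
  push_cast at h2 ⊢
  -- `ν` is unrestricted here. Where `Real.Gamma` takes the value 0, both sides are 0 by the
  -- convention on division.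
  by_cases hG : Real.Gamma ((j : ℝ) + (ν + 1) + 1) = 0
  · simp [hG]
  · field_simp

/-- Termwise differentiation, dominated on `(-T, T)` by an exponential series. Differentiating
raises the order by one, so smoothness and the Bessel equation reduce to relations between
consecutive orders. -/
theorem hasDerivAt_besselEntire {ν : ℝ} (hν : 0 ≤ ν) (t : ℝ) :
    HasDerivAt (besselEntire ν) (-(1 / 4) * besselEntire (ν + 1) t) t := by
  set a : ℕ → ℝ := fun j => (-1 : ℝ) ^ j / ((j.factorial : ℝ) * Real.Gamma ((j : ℝ) + ν + 1))
  set T : ℝ := |t| + 1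
  have hT : 0 < T := by positivity
  set u : ℕ → ℝ := fun j =>
    (Real.Gamma (ν + 1))⁻¹ * ((j.factorial : ℝ))⁻¹ * (j * (T / 4) ^ (j - 1) * (1 / 4))
  have hG0 : 0 < Real.Gamma (ν + 1) := Real.Gamma_pos_of_pos (by linarith)
  have hu : Summable u := by
    rw [← summable_nat_add_iff 1]
    refine ((Real.summable_pow_div_factorial (T / 4)).mul_left
      ((Real.Gamma (ν + 1))⁻¹ * (1 / 4))).congr fun j => ?_
    simp only [u, Nat.add_sub_cancel, Nat.factorial_succ]
    push_cast
    field_simp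
  have key : HasDerivAt (fun z => ∑' j, a j * (z / 4) ^ j)
      (∑' j, a j * (j * (t / 4) ^ (j - 1) * (1 / 4))) t := by
    refine hasDerivAt_tsum_of_isPreconnected hu (t := Set.Ioo (-T) T) isOpen_Ioo
      isPreconnected_Ioo (g := fun j z => a j * (z / 4) ^ j)
      (g' := fun j y => a j * (j * (y / 4) ^ (j - 1) * (1 / 4))) (fun j y _ => ?_) (fun j y hy => ?_)
      (y₀ := t) ?_ (summable_besselEntire hν t) ?_
    · have := (((hasDerivAt_id y).div_const 4).pow j).const_mul (a j)
      simpa using this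
    · have hy' : |y / 4| ≤ T / 4 := by
        rw [abs_div, abs_of_pos (by norm_num : (0 : ℝ) < 4)]
        gcongr
        exact (abs_lt.2 hy).le
      rw [norm_mul, norm_mul, norm_mul, norm_pow]
      simp only [Real.norm_eq_abs, Nat.abs_cast, abs_of_pos (by norm_num : (0 : ℝ) < 1 / 4), u]
      gcongr
      exact abs_besselEntire_coeff_le hν j
    · exact abs_lt.1 (by simp [T])
    · exact abs_lt.1 (by simp [T])
  -- The factor `j` kills the term `j = 0`, so the truncated exponent `j - 1` does no harm there.
  have hval : ∑' j, a j * (j * (t / 4) ^ (j - 1) * (1 / 4)) =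
      -(1 / 4) * besselEntire (ν + 1) t := by
    rw [tsum_eq_zero_add']
    · simp only [CharP.cast_eq_zero, zero_mul, mul_zero, zero_add, Nat.add_sub_cancel]
      rw [besselEntire, ← tsum_mul_left]
      congr 1 with j
      have := besselEntire_coeff_succ (ν := ν) j
      calc _ = (a (j + 1) * ((j + 1 : ℕ) : ℝ)) * ((t / 4) ^ j * (1 / 4)) := by ring
        _ = _ := by simp only [a]; rw [this]; ring
    · refine ((summable_besselEntire (ν := ν + 1) (by linarith) t).mul_left (-(1 / 4))).congr
        fun j => ?_
      have := besselEntire_coeff_succ (ν := ν) j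
      simp only [Nat.add_sub_cancel]
      calc _ = (a (j + 1) * ((j + 1 : ℕ) : ℝ)) * ((t / 4) ^ j * (1 / 4)) := by
              simp only [a]; rw [this]; ring
        _ = _ := by ring
  rw [hval] at key
  exact key

/-- In `Γ(j+ν+2) = (j+ν+1) Γ(j+ν+1)` split the factor as `(ν+1) + j`; the `j` part shifts the index
and yields order `ν+2`. Combined with the derivative formula, this is Bessel's differential
equation. -/
theorem besselEntire_recurrence {ν : ℝ} (hν : 0 ≤ ν) (t : ℝ) :
    besselEntire ν t = (ν + 1) * besselEntire (ν + 1) t - t / 4 * besselEntire (ν + 2) t := by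
  have s1 := summable_besselEntire (ν := ν + 1) (by linarith) t
  have s2 := summable_besselEntire (ν := ν + 2) (by linarith) t
  have e : ∀ j : ℕ, Real.Gamma ((j : ℝ) + (ν + 1) + 1) =
      (j + ν + 1) * Real.Gamma (j + ν + 1) := fun j => by
    rw [← Real.Gamma_add_one (by positivity)]; ring_nf
  have key : ∀ j : ℕ,
      (-1 : ℝ) ^ j / ((j.factorial : ℝ) * Real.Gamma ((j : ℝ) + ν + 1)) * (t / 4) ^ j =
      (ν + 1) * ((-1 : ℝ) ^ j / ((j.factorial : ℝ) * Real.Gamma ((j : ℝ) + (ν + 1) + 1)) *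
        (t / 4) ^ j) +
      (-1 : ℝ) ^ j / ((j.factorial : ℝ) * Real.Gamma ((j : ℝ) + (ν + 1) + 1)) * j *
        (t / 4) ^ j := fun j => by
    have hG : Real.Gamma ((j : ℝ) + ν + 1) ≠ 0 := (Real.Gamma_pos_of_pos (by positivity)).ne'
    have hp : (j : ℝ) + ν + 1 ≠ 0 := by positivity
    rw [e]
    field_simp
    ring
  have shift : ∀ j : ℕ,
      (-1 : ℝ) ^ (j + 1) / (((j + 1).factorial : ℝ) *
        Real.Gamma (((j + 1 : ℕ) : ℝ) + (ν + 1) + 1)) * ((j + 1 : ℕ) : ℝ) * (t / 4) ^ (j + 1) =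
      -(t / 4) * ((-1 : ℝ) ^ j / ((j.factorial : ℝ) * Real.Gamma ((j : ℝ) + (ν + 2) + 1)) *
        (t / 4) ^ j) := fun j => by
    rw [besselEntire_coeff_succ (ν := ν + 1) j, pow_succ, add_assoc ν, one_add_one_eq_two]
    ring
  have s3 : Summable fun j : ℕ =>
      (-1 : ℝ) ^ j / ((j.factorial : ℝ) * Real.Gamma ((j : ℝ) + (ν + 1) + 1)) * j *
        (t / 4) ^ j := by
    rw [← summable_nat_add_iff 1]
    exact (s2.mul_left (-(t / 4))).congr fun j => (shift j).symm
  rw [besselEntire, tsum_congr key, (s1.mul_left _).tsum_add s3, tsum_mul_left,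
    s3.tsum_eq_zero_add]
  simp only [shift]
  rw [tsum_mul_left]
  simp only [besselEntire]
  simp
  ring

theorem contDiff_besselEntire {ν : ℝ} (hν : 0 ≤ ν) : ContDiff ℝ ∞ (besselEntire ν) := by
  rw [contDiff_infty]
  intro m
  induction m generalizing ν with
  | zero =>
    exact contDiff_zero.2 (continuous_iff_continuousAt.2 fun t =>
      (hasDerivAt_besselEntire hν t).continuousAt)
  | succ m ih =>
    push_cast
    rw [contDiff_succ_iff_deriv]
    refine ⟨fun t => (hasDerivAt_besselEntire hν t).differentiableAt, by simp, ?_⟩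
    have : deriv (besselEntire ν) = fun t => -(1 / 4) * besselEntire (ν + 1) t :=
      funext fun t => (hasDerivAt_besselEntire hν t).deriv
    rw [this]
    exact contDiff_const.mul (ih (by linarith))

theorem besselEntire_zero_pos {ν : ℝ} (hν : 0 ≤ ν) : 0 < besselEntire ν 0 := by
  rw [besselEntire, tsum_eq_single 0 fun j hj => by simp [hj]]
  have := Real.Gamma_pos_of_pos (by linarith : 0 < ν + 1)
  simpa using this

theorem besselJ_eq {ν x : ℝ} (hx : 0 < x) :
    besselJ ν x = (x / 2) ^ ν * besselEntire ν (x ^ 2) := by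
  rw [besselJ, besselEntire, ← tsum_mul_left]
  congr 1 with j
  rw [Real.rpow_add (by positivity), Real.rpow_mul (by positivity)]
  have : ((x / 2) ^ (2 : ℝ)) ^ (j : ℝ) = (x ^ 2 / 4) ^ j := by
    rw [Real.rpow_natCast]
    congr 1
    norm_num [div_pow]
  rw [this]
  ring

theorem besselJ_eq_zero_iff {ν x : ℝ} (hx : 0 < x) :
    besselJ ν x = 0 ↔ besselEntire ν (x ^ 2) = 0 := by
  rw [besselJ_eq hx, mul_eq_zero, or_iff_right (Real.rpow_pos_of_pos (by positivity) _).ne']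

theorem hasDerivAt_besselEntire_sq {ν : ℝ} (hν : 0 ≤ ν) (x : ℝ) :
    HasDerivAt (fun x => besselEntire ν (x ^ 2)) (-(x / 2) * besselEntire (ν + 1) (x ^ 2)) x := by
  have h := (hasDerivAt_besselEntire hν (x ^ 2)).comp x (hasDerivAt_pow 2 x)
  refine h.congr_deriv ?_
  push_cast
  ring

/-! ### Positive zeros: simplicity, isolation, unboundedness, enumeration -/

/-- Simplicity of the zeros by an energy argument. With `A = A_ν(y²)` and `P = (y/2) A_{ν+1}(y²)`
one has `(A² + P²)' = -(4ν+2) P²/y`, so `y^N (A² + P²)` is nondecreasing once `N ≥ 4ν+2`. If it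
vanished at `x` it would vanish on all of `(0, x]`, contradicting `A_ν(0) > 0`. -/
theorem besselEntire_succ_ne_zero {ν x : ℝ} (hν : 0 ≤ ν) (hx : 0 < x)
    (h0 : besselEntire ν (x ^ 2) = 0) : besselEntire (ν + 1) (x ^ 2) ≠ 0 := by
  intro h1
  obtain ⟨N, hN⟩ := exists_nat_ge (4 * ν + 4)
  set E : ℝ → ℝ := fun y => y ^ N *
    (besselEntire ν (y ^ 2) ^ 2 + (y / 2 * besselEntire (ν + 1) (y ^ 2)) ^ 2)
  have hE : ∀ y, 0 < y → HasDerivAt E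
      (y ^ (N - 1) * (N * besselEntire ν (y ^ 2) ^ 2 +
        (N - (4 * ν + 2)) * (y / 2 * besselEntire (ν + 1) (y ^ 2)) ^ 2)) y := fun y hy => by
    have hA := hasDerivAt_besselEntire_sq hν y
    have hB := hasDerivAt_besselEntire_sq (ν := ν + 1) (by linarith) y
    have h := (hasDerivAt_pow N y).mul ((hA.pow 2).add
      ((((hasDerivAt_id y).div_const 2).mul hB).pow 2))
    refine h.congr_deriv ?_
    have hr := besselEntire_recurrence hν (y ^ 2)
    have hN1 : N ≠ 0 := by rintro rfl; norm_num at hN; linarith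
    obtain ⟨M, rfl⟩ := Nat.exists_eq_succ_of_ne_zero hN1
    rw [add_assoc ν, one_add_one_eq_two] at *
    simp only [Nat.succ_eq_add_one, Nat.add_sub_cancel, id, Pi.mul_apply, Pi.add_apply,
      Pi.pow_apply]
    rw [hr]
    push_cast
    ring
  have hmono : MonotoneOn E (Set.Ioi 0) := by
    refine monotoneOn_of_deriv_nonneg (convex_Ioi 0)
      (fun y hy => (hE y hy).continuousAt.continuousWithinAt)
      (fun y hy => (hE y (by simpa using hy)).differentiableAt.differentiableWithinAt)
      fun y hy => ?_
    rw [interior_Ioi] at hy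
    rw [(hE y hy).deriv]
    have : (0 : ℝ) ≤ N - (4 * ν + 2) := by linarith
    have hy' : 0 < y := hy
    positivity
  have hzero : ∀ y ∈ Set.Ioc 0 x, besselEntire ν (y ^ 2) = 0 := fun y hy => by
    have h2 := hmono hy.1 hx hy.2
    have h3 : E x = 0 := by simp [E, h0, h1]
    rw [h3] at h2
    have hp : 0 < y ^ N := pow_pos hy.1 _
    have h4 := nonpos_of_mul_nonpos_right h2 hp
    nlinarith [sq_nonneg (besselEntire ν (y ^ 2)),
      sq_nonneg (y / 2 * besselEntire (ν + 1) (y ^ 2))]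
  have hc : ContinuousAt (fun x => besselEntire ν (x ^ 2)) 0 :=
    (hasDerivAt_besselEntire_sq hν 0).continuousAt
  have hev : ∀ᶠ y in 𝓝[>] (0 : ℝ), besselEntire ν (y ^ 2) ≠ 0 := by
    apply nhdsWithin_le_nhds
    apply hc.eventually_ne
    simpa using (besselEntire_zero_pos hν).ne'
  have hev2 : ∀ᶠ y in 𝓝[>] (0 : ℝ), y ∈ Set.Ioc 0 x := Ioc_mem_nhdsGT hx
  obtain ⟨y, hy1, hy2⟩ := (hev.and hev2).exists
  exact hy1 (hzero y hy2)

theorem eventually_besselEntire_sq_ne_zero {ν x : ℝ} (hν : 0 ≤ ν) (hx : 0 ≤ x) :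
    ∀ᶠ y in 𝓝[≠] x, besselEntire ν (y ^ 2) ≠ 0 := by
  have hd := hasDerivAt_besselEntire_sq hν x
  by_cases h0 : besselEntire ν (x ^ 2) = 0
  · have hx' : 0 < x := by
      rcases hx.lt_or_eq with h | rfl
      · exact h
      · exact absurd h0 (by simpa using (besselEntire_zero_pos hν).ne')
    refine hd.eventually_ne ?_
    exact mul_ne_zero (by simpa using hx'.ne') (besselEntire_succ_ne_zero hν hx' h0)
  · exact nhdsWithin_le_nhds (hd.continuousAt.eventually_ne h0)

/-- Sturm comparison. The function `v = x^α A_ν(x²)`, a multiple of `√x J_ν(x)`, solves `v'' + (1 -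
α(α-1)/x²) v = 0`. For `x ≥ 2ν+3` the coefficient is at least `1/4`, so `v` cannot keep its sign
across a half-period of `sin((x-a)/2)`, which solves `y'' + y/4 = 0`. -/
theorem not_besselEntire_sq_constant_sign {ν a s : ℝ} (hν : 0 ≤ ν) (ha : 2 * ν + 3 ≤ a) :
    ¬ ∀ x ∈ Set.Icc a (a + 2 * Real.pi), 0 < s * besselEntire ν (x ^ 2) := by
  intro hpos
  set α : ℝ := ν + 1 / 2
  have ha0 : 0 < a := by linarith
  have hpi := Real.pi_pos
  -- `W = s (v φ' - v' φ)` with `φ = sin((x-a)/2)`. Under the sign assumption it is nondecreasing,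
  -- yet positive at `a` and negative at `a + 2π`.
  set W : ℝ → ℝ := fun x => x ^ α * (s * (besselEntire ν (x ^ 2) * (Real.cos ((x - a) / 2) / 2) -
    (α / x * besselEntire ν (x ^ 2) + -(x / 2) * besselEntire (ν + 1) (x ^ 2)) *
      Real.sin ((x - a) / 2)))
  have hW : ∀ x, 0 < x → HasDerivAt W (x ^ α * ((s * besselEntire ν (x ^ 2)) *
      Real.sin ((x - a) / 2) * (3 / 4 - α * (α - 1) / x ^ 2))) x := fun x hx => by
    have hA := hasDerivAt_besselEntire_sq hν x
    have hB := hasDerivAt_besselEntire_sq (ν := ν + 1) (by linarith) x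
    have hl : HasDerivAt (fun x : ℝ => (x - a) / 2) (1 / 2) x :=
      ((hasDerivAt_id x).sub_const a).div_const 2
    have hcos := hl.cos.div_const 2
    have hsin := hl.sin
    have hinv : HasDerivAt (fun x : ℝ => α / x) (-α / x ^ 2) x := by
      simpa [div_eq_mul_inv, neg_mul] using (hasDerivAt_inv hx.ne').const_mul α
    have hP : HasDerivAt (fun x : ℝ => x ^ α) (x ^ α * (α / x)) x := by
      refine (Real.hasDerivAt_rpow_const (p := α) (Or.inl hx.ne')).congr_deriv ?_
      rw [Real.rpow_sub_one hx.ne']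
      ring
    have hm : HasDerivAt (fun x : ℝ => -(x / 2)) (-(1 / 2)) x :=
      ((hasDerivAt_id x).div_const 2).neg
    have h := hP.mul (((hA.mul hcos).sub (((hinv.mul hA).add (hm.mul hB)).mul hsin)).const_mul s)
    refine h.congr_deriv ?_
    have hr := besselEntire_recurrence hν (x ^ 2)
    rw [add_assoc ν, one_add_one_eq_two]
    simp only [Pi.mul_apply, Pi.add_apply, Pi.sub_apply]
    have hC : x ^ 2 * besselEntire (ν + 2) (x ^ 2) =
        4 * ((ν + 1) * besselEntire (ν + 1) (x ^ 2) - besselEntire ν (x ^ 2)) := by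
      linarith
    have hC' : besselEntire (ν + 2) (x ^ 2) =
        4 * ((ν + 1) * besselEntire (ν + 1) (x ^ 2) - besselEntire ν (x ^ 2)) / x ^ 2 := by
      rw [← hC]; field_simp
    rw [hC']
    simp only [α]
    field_simp
    ring
  have hmono : MonotoneOn W (Set.Icc a (a + 2 * Real.pi)) := by
    refine monotoneOn_of_deriv_nonneg (convex_Icc _ _)
      (fun y hy => (hW y (ha0.trans_le hy.1)).continuousAt.continuousWithinAt)
      (fun y hy => (hW y (ha0.trans_le
        (interior_subset hy).1)).differentiableAt.differentiableWithinAt) fun y hy => ?_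
    have hy' := interior_subset hy
    have hy0 : 0 < y := ha0.trans_le hy'.1
    rw [(hW y hy0).deriv]
    have h1 := hpos y hy'
    have h2 : 0 ≤ Real.sin ((y - a) / 2) :=
      Real.sin_nonneg_of_nonneg_of_le_pi (by linarith [hy'.1]) (by linarith [hy'.2])
    have h3 : 0 ≤ 3 / 4 - α * (α - 1) / y ^ 2 := by
      rw [sub_nonneg, div_le_iff₀ (by positivity)]
      have : 2 * ν + 3 ≤ y := ha.trans hy'.1
      simp only [α]
      nlinarith
    have := Real.rpow_nonneg hy0.le α
    positivity
  have h := hmono (Set.left_mem_Icc.2 (by linarith)) (Set.right_mem_Icc.2 (by linarith))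
    (by linarith : a ≤ a + 2 * Real.pi)
  have ea : W a = a ^ α * (s * besselEntire ν (a ^ 2)) / 2 := by
    simp [W]; ring
  have eb : W (a + 2 * Real.pi) = -((a + 2 * Real.pi) ^ α *
      (s * besselEntire ν ((a + 2 * Real.pi) ^ 2)) / 2) := by
    have : (a + 2 * Real.pi - a) / 2 = Real.pi := by ring
    simp only [W, this, Real.cos_pi, Real.sin_pi]; ring
  rw [ea, eb] at h
  have p1 := mul_pos (Real.rpow_pos_of_pos ha0 α) (hpos a (Set.left_mem_Icc.2 (by linarith)))
  have p2 := mul_pos (Real.rpow_pos_of_pos (by linarith : 0 < a + 2 * Real.pi) α)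
    (hpos _ (Set.right_mem_Icc.2 (by linarith)))
  linarith

theorem exists_besselEntire_sq_eq_zero_gt {ν : ℝ} (hν : 0 ≤ ν) (z : ℝ) :
    ∃ x, z < x ∧ 0 < x ∧ besselEntire ν (x ^ 2) = 0 := by
  set a : ℝ := max (2 * ν + 3) (z + 1)
  have ha1 : 2 * ν + 3 ≤ a := le_max_left _ _
  have ha2 : z + 1 ≤ a := le_max_right _ _
  have hcont : Continuous fun x => besselEntire ν (x ^ 2) :=
    continuous_iff_continuousAt.2 fun x => (hasDerivAt_besselEntire_sq hν x).continuousAt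
  by_contra! hne
  have hne' : ∀ x ∈ Set.Icc a (a + 2 * Real.pi), besselEntire ν (x ^ 2) ≠ 0 := fun x hx =>
    hne x (by linarith [hx.1]) (by linarith [hx.1])
  have hpi := Real.pi_pos
  have hI : IsPreconnected (Set.Icc a (a + 2 * Real.pi)) := isPreconnected_Icc
  have hamem : a ∈ Set.Icc a (a + 2 * Real.pi) := Set.left_mem_Icc.2 (by linarith)
  rcases lt_or_gt_of_ne (hne' a hamem) with h | h
  · refine not_besselEntire_sq_constant_sign (s := -1) hν ha1 fun x hx => ?_
    by_contra hx'
    obtain ⟨y, hy, hy0⟩ := hI.intermediate_value hamem hx hcont.continuousOn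
      (show (0 : ℝ) ∈ Set.Icc _ _ from ⟨h.le, by linarith⟩)
    exact hne' y hy hy0
  · refine not_besselEntire_sq_constant_sign (s := 1) hν ha1 fun x hx => ?_
    by_contra hx'
    obtain ⟨y, hy, hy0⟩ := hI.intermediate_value hx hamem hcont.continuousOn
      (show (0 : ℝ) ∈ Set.Icc _ _ from ⟨by linarith, h.le⟩)
    exact hne' y hy hy0

/-- The set of larger zeros is nonempty since zeros are unbounded. Isolation from the right, valid
at 0 too, makes its infimum strictly larger than the previous term, and continuity makes that
infimum a zero. -/
theorem besselJZero_nonneg_and_succ_spec {ν : ℝ} (hν : 0 ≤ ν) (m : ℕ) :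
    0 ≤ besselJZero ν m ∧ besselJZero ν m < besselJZero ν (m + 1) ∧
      besselEntire ν (besselJZero ν (m + 1) ^ 2) = 0 := by
  have hcont : Continuous fun x => besselEntire ν (x ^ 2) :=
    continuous_iff_continuousAt.2 fun x => (hasDerivAt_besselEntire_sq hν x).continuousAt
  have step : ∀ z : ℝ, 0 ≤ z →
      z < sInf {x : ℝ | z < x ∧ besselJ ν x = 0} ∧
      besselEntire ν (sInf {x : ℝ | z < x ∧ besselJ ν x = 0} ^ 2) = 0 := fun z hz => by
    set S := {x : ℝ | z < x ∧ besselJ ν x = 0}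
    have hS : S.Nonempty := by
      obtain ⟨x, hzx, hx, h0⟩ := exists_besselEntire_sq_eq_zero_gt hν z
      exact ⟨x, hzx, (besselJ_eq_zero_iff hx).2 h0⟩
    have hbdd : BddBelow S := ⟨z, fun x hx => hx.1.le⟩
    have hzero : ∀ x ∈ S, besselEntire ν (x ^ 2) = 0 := fun x hx =>
      (besselJ_eq_zero_iff (hz.trans_lt hx.1)).1 hx.2
    refine ⟨?_, ?_⟩
    · have hev := (eventually_besselEntire_sq_ne_zero hν hz).filter_mono
        (nhdsWithin_mono z (fun y (hy : z < y) => hy.ne') : 𝓝[>] z ≤ 𝓝[≠] z)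
      obtain ⟨b, hb, hsub⟩ := (mem_nhdsGT_iff_exists_Ioo_subset).1 hev
      refine lt_of_lt_of_le hb (le_csInf hS fun x hx => ?_)
      by_contra! hlt
      exact hsub ⟨hx.1, hlt⟩ (hzero x hx)
    · have hcl := csInf_mem_closure hS hbdd
      exact closure_minimal (s := S) (t := {x | besselEntire ν (x ^ 2) = 0}) hzero
        (isClosed_eq hcont continuous_const) hcl
  have hnn : ∀ m, 0 ≤ besselJZero ν m := fun m => by
    induction m with
    | zero => simp [besselJZero]
    | succ m ih => exact ih.trans (step _ ih).1.le
  exact ⟨hnn m, step _ (hnn m)⟩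

/-- A zero missed by the enumeration would bound the strictly increasing sequence from above; its
limit would be an accumulation point of zeros. -/
theorem exists_besselJZero_eq {ν x : ℝ} (hν : 0 ≤ ν) (hx : 0 < x)
    (h0 : besselEntire ν (x ^ 2) = 0) : ∃ m, 1 ≤ m ∧ besselJZero ν m = x := by
  have hcont : Continuous fun x => besselEntire ν (x ^ 2) :=
    continuous_iff_continuousAt.2 fun x => (hasDerivAt_besselEntire_sq hν x).continuousAt
  by_contra! hne
  have hlt : ∀ m, besselJZero ν m < x := fun m => by
    induction m with
    | zero => simpa [besselJZero] using hx
    | succ m ih =>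
      refine lt_of_le_of_ne ?_ (hne (m + 1) (by omega))
      exact csInf_le ⟨besselJZero ν m, fun y hy => hy.1.le⟩ ⟨ih, (besselJ_eq_zero_iff hx).2 h0⟩
  have hmono : StrictMono (besselJZero ν) :=
    strictMono_nat_of_lt_succ fun m => (besselJZero_nonneg_and_succ_spec hν m).2.1
  have hbdd : BddAbove (Set.range (besselJZero ν)) := ⟨x, by rintro _ ⟨m, rfl⟩; exact (hlt m).le⟩
  have hlim := tendsto_atTop_ciSup hmono.monotone hbdd
  set s := ⨆ m, besselJZero ν m
  have hle : ∀ m, besselJZero ν m < s := fun m =>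
    (hmono (Nat.lt_succ_self m)).trans_le (le_ciSup hbdd (m + 1))
  have hs : 0 ≤ s := (hle 0).le
  have hlim' : Tendsto (fun m => besselJZero ν (m + 1)) atTop (𝓝[≠] s) :=
    tendsto_nhdsWithin_iff.2 ⟨hlim.comp (tendsto_add_atTop_nat 1),
      Eventually.of_forall fun m => (hle (m + 1)).ne⟩
  obtain ⟨m, hm⟩ := (hlim'.eventually (eventually_besselEntire_sq_ne_zero hν hs)).exists
  exact hm (besselJZero_nonneg_and_succ_spec hν m).2.2

/-! ### Gradients, Laplacians and integration by parts -/

section Calculus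

variable {E : Type*} [NormedAddCommGroup E] [InnerProductSpace ℝ E]

theorem contDiff_comp_norm_sq {G : ℝ → ℝ} {m : WithTop ℕ∞} (h : ContDiff ℝ m G) :
    ContDiff ℝ m fun y : E => G (‖y‖ ^ 2) :=
  h.comp (contDiff_norm_sq ℝ)

variable [FiniteDimensional ℝ E]

theorem laplacian_eq_sum_fderiv_fderiv {f : E → ℝ} (hf : ContDiff ℝ 2 f) (x : E) :
    Δ f x = ∑ i, fderiv ℝ (fun y => fderiv ℝ f y (stdOrthonormalBasis ℝ E i)) x
      (stdOrthonormalBasis ℝ E i) := by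
  rw [InnerProductSpace.laplacian_eq_iteratedFDeriv_stdOrthonormalBasis]
  refine Finset.sum_congr rfl fun i _ => ?_
  have h : ContDiff ℝ 1 (fderiv ℝ f) := hf.fderiv_right (by norm_num)
  rw [iteratedFDeriv_two_apply, fderiv_clm_apply ((h.differentiable (by norm_num)) x)
    (differentiableAt_const _)]
  simp

theorem continuous_laplacian {f : E → ℝ} (hf : ContDiff ℝ 2 f) : Continuous (Δ f) := by
  have h : ContDiff ℝ 1 (fderiv ℝ f) := hf.fderiv_right (by norm_num)
  have : Δ f = fun x => ∑ i, fderiv ℝ (fun y => fderiv ℝ f y (stdOrthonormalBasis ℝ E i)) x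
      (stdOrthonormalBasis ℝ E i) := funext fun x => laplacian_eq_sum_fderiv_fderiv hf x
  rw [this]
  refine continuous_finsetSum _ fun i _ => ?_
  have h2 : ContDiff ℝ 1 fun y => fderiv ℝ f y (stdOrthonormalBasis ℝ E i) :=
    h.clm_apply contDiff_const
  exact (h2.continuous_fderiv (by norm_num)).clm_apply continuous_const

theorem continuous_gradient {f : E → ℝ} (hf : ContDiff ℝ 1 f) : Continuous (∇ f) :=
  (InnerProductSpace.toDual ℝ E).symm.continuous.comp (hf.continuous_fderiv (by norm_num))

theorem tsupport_gradient_subset (f : E → ℝ) : tsupport (∇ f) ⊆ tsupport f := by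
  refine closure_minimal (fun x hx => ?_) (isClosed_tsupport f)
  refine support_fderiv_subset ℝ (f := f) fun h0 => hx ?_
  simp [gradient, h0]

theorem hasCompactSupport_gradient {f : E → ℝ} (hf : HasCompactSupport f) :
    HasCompactSupport (∇ f) :=
  IsCompact.of_isClosed_subset hf (isClosed_tsupport _) (tsupport_gradient_subset f)

theorem hasGradientAt_comp_norm_sq {G : ℝ → ℝ} {G' : ℝ} {x : E}
    (h : HasDerivAt G G' (‖x‖ ^ 2)) :
    HasGradientAt (fun y => G (‖y‖ ^ 2)) ((2 * G') • x) x := by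
  rw [hasGradientAt_iff_hasFDerivAt]
  have h1 : HasFDerivAt (fun y : E => ‖y‖ ^ 2) (2 • innerSL ℝ x) x :=
    (hasStrictFDerivAt_norm_sq x).hasFDerivAt
  refine (h.comp_hasFDerivAt x h1).congr_fderiv ?_
  ext y
  simp
  ring

/-- Using `‖x‖²` rather than `‖x‖` as the radial variable keeps the formula free of a singularity at
the origin. -/
theorem laplacian_comp_norm_sq {G G' G'' : ℝ → ℝ} (hG : ContDiff ℝ 2 G)
    (h1 : ∀ t, HasDerivAt G (G' t) t) (h2 : ∀ t, HasDerivAt G' (G'' t) t) (x : E) :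
    Δ (fun y : E => G (‖y‖ ^ 2)) x =
      4 * ‖x‖ ^ 2 * G'' (‖x‖ ^ 2) + 2 * Module.finrank ℝ E * G' (‖x‖ ^ 2) := by
  rw [laplacian_eq_sum_fderiv_fderiv (contDiff_comp_norm_sq hG)]
  have e1 : ∀ v : E, (fun y : E => fderiv ℝ (fun y : E => G (‖y‖ ^ 2)) y v) =
      fun y => 2 * G' (‖y‖ ^ 2) * inner ℝ y v := fun v => funext fun y => by
    rw [(hasGradientAt_comp_norm_sq (h1 _)).fderiv_apply, inner_smul_left]
    simp
  have e2 : ∀ v : E, fderiv ℝ (fun y : E => 2 * G' (‖y‖ ^ 2) * inner ℝ y v) x v =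
      4 * G'' (‖x‖ ^ 2) * inner ℝ x v ^ 2 + 2 * G' (‖x‖ ^ 2) * ‖v‖ ^ 2 := fun v => by
    have ha := (hasGradientAt_comp_norm_sq (x := x) (h2 _)).hasFDerivAt.const_mul 2
    have hb : HasFDerivAt (fun y : E => inner ℝ y v) (innerSL ℝ v) x := by
      simpa [real_inner_comm] using (innerSL ℝ v).hasFDerivAt (x := x)
    rw [(ha.fun_mul hb).fderiv]
    simp
    ring
  simp only [e1, e2, Finset.sum_add_distrib, ← Finset.mul_sum, OrthonormalBasis.sum_sq_inner_left,
    OrthonormalBasis.norm_eq_one]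
  simp
  ring

variable [MeasurableSpace E] [BorelSpace E]

theorem integral_inner_gradient_eq_neg {f φ : E → ℝ} (hf : ContDiff ℝ 2 f) (hφ : ContDiff ℝ 1 φ)
    (hc : HasCompactSupport φ) :
    ∫ x, inner ℝ (∇ f x) (∇ φ x) = -∫ x, φ x * Δ f x := by
  set b := stdOrthonormalBasis ℝ E
  have hf1 : ContDiff ℝ 1 (fderiv ℝ f) := hf.fderiv_right (by norm_num)
  have hd : ∀ i, ContDiff ℝ 1 fun y => fderiv ℝ f y (b i) := fun i =>
    hf1.clm_apply contDiff_const
  have hdφ : ∀ i, Continuous fun y => fderiv ℝ φ y (b i) := fun i =>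
    (hφ.continuous_fderiv (by norm_num)).clm_apply continuous_const
  have hcφ : ∀ i, HasCompactSupport fun y => fderiv ℝ φ y (b i) := fun i =>
    (hc.fderiv (𝕜 := ℝ)).comp_left (g := fun L : E →L[ℝ] ℝ => L (b i)) (by simp)
  have hdd : ∀ i, Continuous fun y => fderiv ℝ (fun y => fderiv ℝ f y (b i)) y (b i) := fun i =>
    ((hd i).continuous_fderiv (by norm_num)).clm_apply continuous_const
  have i1 : ∀ i, Integrable fun x => fderiv ℝ f x (b i) * fderiv ℝ φ x (b i) := fun i =>
    ((hd i).continuous.mul (hdφ i)).integrable_of_hasCompactSupport (hcφ i).mul_left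
  have i2 : ∀ i, Integrable fun x =>
      φ x * fderiv ℝ (fun y => fderiv ℝ f y (b i)) x (b i) := fun i =>
    (hφ.continuous.mul (hdd i)).integrable_of_hasCompactSupport hc.mul_right
  calc ∫ x, inner ℝ (∇ f x) (∇ φ x)
      = ∫ x, ∑ i, fderiv ℝ f x (b i) * fderiv ℝ φ x (b i) := by
        congr 1 with x
        rw [← b.sum_inner_mul_inner]
        refine Finset.sum_congr rfl fun i _ => ?_
        rw [inner_gradient_left, inner_gradient_right]
        simp
    _ = ∑ i, ∫ x, fderiv ℝ f x (b i) * fderiv ℝ φ x (b i) := integral_finsetSum _ fun i _ => i1 i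
    _ = ∑ i, -∫ x, φ x * fderiv ℝ (fun y => fderiv ℝ f y (b i)) x (b i) := by
        refine Finset.sum_congr rfl fun i _ => ?_
        rw [integral_mul_fderiv_eq_neg_fderiv_mul_of_integrable]
        · simp only [mul_comm]
        · simpa only [mul_comm] using i2 i
        · exact i1 i
        · exact ((hd i).continuous.mul hφ.continuous).integrable_of_hasCompactSupport hc.mul_left
        · exact fun x _ => (hd i).differentiable (by norm_num) x
        · exact fun x _ => hφ.differentiable (by norm_num) x
    _ = -∫ x, φ x * Δ f x := by
        rw [Finset.sum_neg_distrib, ← integral_finsetSum _ fun i _ => i2 i]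
        congr 2 with x
        rw [laplacian_eq_sum_fderiv_fderiv hf, Finset.mul_sum]

end Calculus

/-! ### The regular radial Helmholtz solution -/

section Helmholtz

variable {E : Type*} [NormedAddCommGroup E] [InnerProductSpace ℝ E]

/-- The multiple `(k|x|/2)^{-ν} J_ν(k|x|)` of a Bessel function; for `ν = (dim - 2)/2` it is the radial
solution of the Helmholtz equation that is regular at the origin. -/
noncomputable def radialBessel (ν k : ℝ) (x : E) : ℝ := besselEntire ν (k ^ 2 * ‖x‖ ^ 2)

theorem hasDerivAt_besselEntire_const_mul {ν : ℝ} (hν : 0 ≤ ν) (c t : ℝ) :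
    HasDerivAt (fun t => besselEntire ν (c * t))
      (c * (-(1 / 4) * besselEntire (ν + 1) (c * t))) t := by
  have h := (hasDerivAt_besselEntire hν (c * t)).comp t ((hasDerivAt_id t).const_mul c)
  refine h.congr_deriv ?_
  simp; ring

theorem contDiff_radialBessel {ν : ℝ} (hν : 0 ≤ ν) (k : ℝ) :
    ContDiff ℝ ∞ (radialBessel ν k : E → ℝ) :=
  contDiff_comp_norm_sq (G := fun t => besselEntire ν (k ^ 2 * t))
    ((contDiff_besselEntire hν).comp (contDiff_const.mul contDiff_id))

variable [FiniteDimensional ℝ E]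

theorem gradient_radialBessel {ν : ℝ} (hν : 0 ≤ ν) (k : ℝ) (x : E) :
    ∇ (radialBessel ν k : E → ℝ) x =
      (-(k ^ 2 / 2) * besselEntire (ν + 1) (k ^ 2 * ‖x‖ ^ 2)) • x := by
  have h := (hasGradientAt_comp_norm_sq (x := x)
    (hasDerivAt_besselEntire_const_mul hν (k ^ 2) _)).gradient
  refine h.trans ?_
  congr 1
  ring

theorem laplacian_radialBessel {ν : ℝ} (hν : 0 ≤ ν) (hE : (Module.finrank ℝ E : ℝ) = 2 * ν + 2)
    (k : ℝ) (x : E) : Δ (radialBessel ν k : E → ℝ) x = -k ^ 2 * radialBessel ν k x := by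
  have h := laplacian_comp_norm_sq (E := E) (G := fun t => besselEntire ν (k ^ 2 * t))
    (contDiff_infty.1 ((contDiff_besselEntire hν).comp (contDiff_const.mul contDiff_id)) 2)
    (hasDerivAt_besselEntire_const_mul hν (k ^ 2))
    (fun t => ((hasDerivAt_besselEntire_const_mul (by linarith : 0 ≤ ν + 1) (k ^ 2) t).const_mul
      (-(1 / 4))).const_mul (k ^ 2)) x
  refine h.trans ?_
  rw [radialBessel, besselEntire_recurrence hν, hE, add_assoc ν, one_add_one_eq_two]
  ring

theorem laplacian_norm_sq_pow (j : ℕ) (x : E) :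
    Δ (fun y : E => (‖y‖ ^ 2) ^ (j + 1)) x =
      2 * (j + 1) * (2 * j + Module.finrank ℝ E) * (‖x‖ ^ 2) ^ j := by
  have h := laplacian_comp_norm_sq (E := E) (G := fun t => t ^ (j + 1))
    (G' := fun t => (j + 1) * t ^ j) (G'' := fun t => (j + 1) * (j * t ^ (j - 1)))
    (contDiff_id.pow _) (fun t => by simpa using hasDerivAt_pow (j + 1) t)
    (fun t => (hasDerivAt_pow j t).const_mul _) x
  refine h.trans ?_
  rcases j with _ | j
  · simp
  · simp only [Nat.add_sub_cancel]
    push_cast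
    ring

end Helmholtz

/-! ### Convergence in `L²` on finite measure spaces -/

section Convergence

variable {α F : Type*} [MeasurableSpace α] {μ : Measure α} [IsFiniteMeasure μ]
  [NormedAddCommGroup F]

theorem tendsto_eLpNorm_two_of_bounded {f : ℕ → α → F} {g : α → F} {C : ℝ}
    (hf : ∀ j, AEStronglyMeasurable (f j) μ) (hg : AEStronglyMeasurable g μ)
    (hb : ∀ j, ∀ᵐ x ∂μ, ‖f j x - g x‖ ≤ C)
    (hlim : ∀ᵐ x ∂μ, Tendsto (fun j => f j x) atTop (𝓝 (g x))) :
    Tendsto (fun j => eLpNorm (fun x => f j x - g x) 2 μ) atTop (𝓝 0) := by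
  have h := tendsto_lintegral_of_dominated_convergence' (μ := μ)
    (F := fun j x => ‖f j x - g x‖ₑ ^ (2 : ℝ)) (f := fun _ => 0)
    (fun _ => ENNReal.ofReal C ^ (2 : ℝ)) (fun j => ((hf j).sub hg).enorm.pow_const 2)
    (fun j => (hb j).mono fun x hx => by
      refine ENNReal.rpow_le_rpow ?_ (by norm_num)
      rw [← ofReal_norm]
      exact ENNReal.ofReal_le_ofReal hx)
    (by
      rw [lintegral_const]
      exact ENNReal.mul_ne_top (ENNReal.rpow_ne_top_of_nonneg (by norm_num) ENNReal.ofReal_ne_top)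
        (measure_ne_top μ _))
    (hlim.mono fun x hx => by
      have h1 : Tendsto (fun j => f j x - g x) atTop (𝓝 0) := by
        simpa using hx.sub_const (g x)
      have h2 := (ENNReal.continuous_rpow_const (y := 2)).tendsto 0 |>.comp
        (by simpa using h1.enorm)
      simpa [Function.comp_def] using h2)
  have h3 := (ENNReal.continuous_rpow_const (y := 1 / 2)).tendsto _ |>.comp h
  have h4 : (0 : ℝ≥0∞) ^ (1 / 2 : ℝ) = 0 := ENNReal.zero_rpow_of_pos (by norm_num)
  simp only [lintegral_const, zero_mul, h4] at h3
  refine h3.congr fun j => ?_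
  rw [eLpNorm_eq_lintegral_rpow_enorm_toReal (by norm_num) (by norm_num)]
  simp

variable [InnerProductSpace ℝ F]

theorem tendsto_integral_inner_of_tendsto_eLpNorm {f : ℕ → α → F} {g h : α → F} {C : ℝ}
    (hf : ∀ j, MemLp (f j) 2 μ) (hg : MemLp g 2 μ) (hh : AEStronglyMeasurable h μ)
    (hb : ∀ᵐ x ∂μ, ‖h x‖ ≤ C)
    (hlim : Tendsto (fun j => eLpNorm (fun x => f j x - g x) 2 μ) atTop (𝓝 0)) :
    Tendsto (fun j => ∫ x, inner ℝ (f j x) (h x) ∂μ) atTop (𝓝 (∫ x, inner ℝ (g x) (h x) ∂μ)) := by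
  have hint : ∀ u : α → F, MemLp u 2 μ → Integrable (fun x => inner ℝ (u x) (h x)) μ := fun u hu =>
    ((hu.integrable (by norm_num)).norm.mul_const C).mono' (hu.1.inner hh)
      (hb.mono fun x hx => (norm_inner_le_norm _ _).trans (by gcongr))
  refine tendsto_integral_of_L1' _ (hint g hg).1 (Eventually.of_forall fun j => hint _ (hf j)) ?_
  -- The Hölder constant of the embedding of `L²` into `L¹`.
  set K : ℝ≥0∞ := μ Set.univ ^ (1 / (1 : ℝ≥0∞).toReal - 1 / (2 : ℝ≥0∞).toReal)
  have hK : K ≠ ⊤ := ENNReal.rpow_ne_top_of_nonneg (by norm_num [ENNReal.toReal_ofNat]) (measure_ne_top μ _)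
  have hup : Tendsto (fun j => ENNReal.ofReal C * (eLpNorm (fun x => f j x - g x) 2 μ * K)) atTop
      (𝓝 0) := by
    have := ENNReal.Tendsto.const_mul (a := ENNReal.ofReal C)
      (ENNReal.Tendsto.mul_const hlim (Or.inr hK)) (Or.inr ENNReal.ofReal_ne_top)
    simpa using this
  refine tendsto_of_tendsto_of_tendsto_of_le_of_le tendsto_const_nhds hup (fun j => zero_le)
    fun j => ?_
  calc eLpNorm ((fun x => inner ℝ (f j x) (h x)) - fun x => inner ℝ (g x) (h x)) 1 μ
      ≤ ENNReal.ofReal C * eLpNorm (fun x => f j x - g x) 1 μ := by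
        refine eLpNorm_le_mul_eLpNorm_of_ae_le_mul (hb.mono fun x hx => ?_) 1
        simp only [Pi.sub_apply]
        rw [← inner_sub_left, mul_comm]
        exact (norm_inner_le_norm _ _).trans (by gcongr)
    _ ≤ _ := by
        gcongr
        exact eLpNorm_le_eLpNorm_mul_rpow_measure_univ (by norm_num) ((hf j).1.sub hg.1)

end Convergence

/-! ### Cutoffs near the boundary of the ball -/

section Cutoff

theorem deriv_smoothTransition_of_one_lt {t : ℝ} (ht : 1 < t) :
    deriv Real.smoothTransition t = 0 := by
  have : Real.smoothTransition =ᶠ[𝓝 t] fun _ => 1 :=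
    (eventually_gt_nhds ht).mono fun y hy => Real.smoothTransition.one_of_one_le hy.le
  rw [this.deriv_eq, deriv_const]

theorem deriv_smoothTransition_of_neg {t : ℝ} (ht : t < 0) :
    deriv Real.smoothTransition t = 0 := by
  have : Real.smoothTransition =ᶠ[𝓝 t] fun _ => 0 :=
    (eventually_lt_nhds ht).mono fun y hy => Real.smoothTransition.zero_of_nonpos hy.le
  rw [this.deriv_eq, deriv_const]

theorem exists_abs_deriv_smoothTransition_le :
    ∃ M, 0 ≤ M ∧ ∀ t, |deriv Real.smoothTransition t| ≤ M := by
  have hc : Continuous (deriv Real.smoothTransition) :=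
    (Real.smoothTransition.contDiff (n := 1)).continuous_deriv (by norm_num)
  obtain ⟨M, hM⟩ := (isCompact_Icc (a := (0 : ℝ)) (b := 1)).exists_bound_of_continuousOn
    hc.continuousOn
  have hM0 : 0 ≤ M := (norm_nonneg _).trans (hM 0 (by simp))
  refine ⟨M, hM0, fun t => ?_⟩
  rcases lt_or_ge t 0 with h | h
  · simpa [deriv_smoothTransition_of_neg h] using hM0
  rcases lt_or_ge 1 t with h' | h'
  · simpa [deriv_smoothTransition_of_one_lt h'] using hM0
  exact hM t ⟨h, h'⟩

variable {E : Type*} [NormedAddCommGroup E]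

/-- Smooth cutoffs compactly supported in the ball of radius `R` and increasing to its indicator. -/
noncomputable def ballCutoff (R : ℝ) (j : ℕ) (x : E) : ℝ :=
  Real.smoothTransition ((j + 1) * (R ^ 2 - ‖x‖ ^ 2) - 1)

theorem abs_ballCutoff_le_one (R : ℝ) (j : ℕ) (x : E) : |ballCutoff R j x| ≤ 1 := by
  rw [ballCutoff, abs_of_nonneg (Real.smoothTransition.nonneg _)]
  exact Real.smoothTransition.le_one _

theorem tsupport_ballCutoff_subset {R : ℝ} (hR : 0 < R) (j : ℕ) :
    tsupport (ballCutoff R j : E → ℝ) ⊆ ball 0 R := by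
  have h1 : tsupport (ballCutoff R j : E → ℝ) ⊆ {x | 1 ≤ (j + 1) * (R ^ 2 - ‖x‖ ^ 2)} := by
    refine closure_minimal (fun x hx => ?_) (isClosed_le continuous_const (by fun_prop))
    by_contra hx'
    exact hx (Real.smoothTransition.zero_of_nonpos (by
      simp only [Set.mem_ofPred_eq, not_le] at hx'
      linarith))
  refine h1.trans fun x hx => ?_
  have h2 : 0 < R ^ 2 - ‖x‖ ^ 2 := by
    by_contra! h
    have := mul_nonpos_of_nonneg_of_nonpos (by positivity : (0 : ℝ) ≤ j + 1) h
    simp only [Set.mem_ofPred_eq] at hx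
    linarith
  rw [mem_ball_zero_iff]
  exact lt_of_pow_lt_pow_left₀ 2 hR.le (by linarith)

theorem eventually_one_lt_ballCutoff_arg {R : ℝ} {x : E} (hx : x ∈ ball (0 : E) R) :
    ∀ᶠ j : ℕ in atTop, 1 < ((j : ℝ) + 1) * (R ^ 2 - ‖x‖ ^ 2) - 1 := by
  rw [mem_ball_zero_iff] at hx
  have h : 0 < R ^ 2 - ‖x‖ ^ 2 := by nlinarith [norm_nonneg x]
  have : Tendsto (fun j : ℕ => ((j : ℝ) + 1) * (R ^ 2 - ‖x‖ ^ 2) - 1) atTop atTop :=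
    tendsto_atTop_add_const_right _ _ ((tendsto_atTop_add_const_right _ _
      tendsto_natCast_atTop_atTop).atTop_mul_const h)
  exact this.eventually_gt_atTop 1

variable [InnerProductSpace ℝ E]

theorem contDiff_ballCutoff (R : ℝ) (j : ℕ) : ContDiff ℝ ∞ (ballCutoff R j : E → ℝ) :=
  Real.smoothTransition.contDiff.comp
    ((contDiff_const.mul (contDiff_const.sub (contDiff_norm_sq ℝ))).sub contDiff_const)

variable [FiniteDimensional ℝ E]

theorem gradient_ballCutoff (R : ℝ) (j : ℕ) (x : E) :
    ∇ (ballCutoff R j : E → ℝ) x = (2 * (-(j + 1) *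
      deriv Real.smoothTransition ((j + 1) * (R ^ 2 - ‖x‖ ^ 2) - 1))) • x := by
  have hS : ∀ t, HasDerivAt Real.smoothTransition (deriv Real.smoothTransition t) t := fun t =>
    ((Real.smoothTransition.contDiff (n := 1)).differentiable (by norm_num) t).hasDerivAt
  refine (hasGradientAt_comp_norm_sq
    (G := fun t => Real.smoothTransition ((j + 1) * (R ^ 2 - t) - 1)) ?_).gradient
  have hl : HasDerivAt (fun t : ℝ => ((j : ℝ) + 1) * (R ^ 2 - t) - 1) (-((j : ℝ) + 1)) (‖x‖ ^ 2) := by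
    simpa using (((hasDerivAt_id (‖x‖ ^ 2)).const_sub (R ^ 2)).const_mul ((j : ℝ) + 1)).sub_const 1
  exact ((hS _).comp _ hl).congr_deriv (by ring)

theorem gradient_mul {f g : E → ℝ} {x : E} (hf : DifferentiableAt ℝ f x)
    (hg : DifferentiableAt ℝ g x) :
    ∇ (fun y => f y * g y) x = f x • ∇ g x + g x • ∇ f x := by
  refine HasGradientAt.gradient ?_
  rw [hasGradientAt_iff_hasFDerivAt]
  refine (hf.hasFDerivAt.fun_mul hg.hasFDerivAt).congr_fderiv ?_
  simp

/-- Mean value inequality on the segment to a nearest boundary point. This linear decay at the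
boundary compensates for the growing gradients of the cutoffs. -/
theorem exists_abs_le_mul_of_eq_zero_on_sphere [Nontrivial E] {R : ℝ} (hR : 0 < R) {η : E → ℝ}
    (hη : ContDiff ℝ 1 η) (h0 : ∀ x ∈ sphere (0 : E) R, η x = 0) :
    ∃ L, 0 ≤ L ∧ (∀ x ∈ closedBall (0 : E) R, ‖∇ η x‖ ≤ L) ∧
      ∀ x ∈ closedBall (0 : E) R, |η x| ≤ L * (R - ‖x‖) := by
  obtain ⟨L, hL⟩ := (isCompact_closedBall (0 : E) R).exists_bound_of_continuousOn
    (hη.continuous_fderiv (by norm_num)).continuousOn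
  refine ⟨L, (norm_nonneg _).trans (hL 0 (by simp [hR.le])), fun x hx => ?_, fun x hx => ?_⟩
  · rw [gradient, LinearIsometryEquiv.norm_map]
    exact hL x hx
  · obtain ⟨y, hy, hyx⟩ : ∃ y ∈ sphere (0 : E) R, ‖x - y‖ = R - ‖x‖ := by
      rcases eq_or_ne x 0 with rfl | hx0
      · obtain ⟨y, hy⟩ := exists_norm_eq E hR.le
        exact ⟨y, by simpa using hy, by simp [hy]⟩
      · have hx' : 0 < ‖x‖ := norm_pos_iff.2 hx0
        have hle : ‖x‖ ≤ R := by simpa using hx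
        refine ⟨(R / ‖x‖) • x, ?_, ?_⟩
        · rw [mem_sphere_zero_iff_norm, norm_smul, Real.norm_of_nonneg (by positivity)]
          field_simp
        · have : x - (R / ‖x‖) • x = (1 - R / ‖x‖) • x := by rw [sub_smul, one_smul]
          rw [this, norm_smul, Real.norm_eq_abs, abs_sub_comm, abs_of_nonneg]
          · field_simp
          · rw [sub_nonneg, le_div_iff₀ hx']; linarith
    have h := (convex_closedBall (0 : E) R).norm_image_sub_le_of_norm_fderiv_le (𝕜 := ℝ)
      (fun z _ => hη.differentiable (by norm_num) z) hL (sphere_subset_closedBall hy) hx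
    rwa [h0 y hy, sub_zero, Real.norm_eq_abs, hyx] at h

end Cutoff

/-! ### Smooth functions vanishing on the sphere as test functions -/

section H10

variable {n : ℕ}

/-- Multiply `η` by `ballCutoff R j`. The gradient of the cutoff is at most `2(j+1)MR` and vanishes
unless `(j+1) R (R-|x|) ≤ 2`; there `|η| ≤ L(R-|x|)`, so the dangerous term `η∇(cutoff)` stays below
`4ML`. Each point of the ball eventually lies where the cutoff is locally 1, so dominated
convergence applies to values and gradients. -/
theorem exists_testFunction_approx [NeZero n] {R : ℝ} (hR : 0 < R)
    {η : EuclideanSpace ℝ (Fin n) → ℝ} (hη : ContDiff ℝ ∞ η)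
    (h0 : ∀ x ∈ sphere (0 : EuclideanSpace ℝ (Fin n)) R, η x = 0) :
    ∃ (φ : ℕ → EuclideanSpace ℝ (Fin n) → ℝ) (C : ℝ),
      (∀ j, IsTestFunctionOn (ball 0 R) (φ j)) ∧
      (∀ j, ∀ x ∈ ball (0 : EuclideanSpace ℝ (Fin n)) R, |φ j x| ≤ C ∧ ‖∇ (φ j) x‖ ≤ C) ∧
      (∀ x ∈ ball (0 : EuclideanSpace ℝ (Fin n)) R, |η x| ≤ C ∧ ‖∇ η x‖ ≤ C) ∧
      ∀ x ∈ ball (0 : EuclideanSpace ℝ (Fin n)) R,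
        Tendsto (fun j => φ j x) atTop (𝓝 (η x)) ∧
        Tendsto (fun j => ∇ (φ j) x) atTop (𝓝 (∇ η x)) := by
  obtain ⟨M, hM0, hM⟩ := exists_abs_deriv_smoothTransition_le
  obtain ⟨L, hL0, hL1, hL2⟩ :=
    exists_abs_le_mul_of_eq_zero_on_sphere hR (contDiff_infty.1 hη 1) h0
  have hgrad : ∀ j x, ∇ (fun y => ballCutoff R j y * η y) x =
      ballCutoff R j x • ∇ η x + η x • ∇ (ballCutoff R j) x := fun j x =>
    gradient_mul ((contDiff_ballCutoff R j).differentiable (by simp) x)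
      (hη.differentiable (by simp) x)
  have hηle : ∀ x ∈ ball (0 : EuclideanSpace ℝ (Fin n)) R, |η x| ≤ L * R := fun x hx =>
    (hL2 x (ball_subset_closedBall hx)).trans (by gcongr; linarith [norm_nonneg x])
  have hpos : 0 ≤ L * R := by positivity
  have hpos' : 0 ≤ 4 * M * L := by positivity
  refine ⟨fun j x => ballCutoff R j x * η x, L * R + L + 4 * M * L, fun j => ⟨?_, ?_, ?_⟩,
    fun j x hx => ⟨?_, ?_⟩, fun x hx => ⟨?_, ?_⟩, fun x hx => ⟨?_, ?_⟩⟩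
  · exact (contDiff_ballCutoff R j).mul hη
  · exact (HasCompactSupport.of_support_subset_isCompact
      ((isCompact_closedBall (0 : EuclideanSpace ℝ (Fin n)) R))
      ((subset_tsupport _).trans ((tsupport_ballCutoff_subset hR j).trans
        ball_subset_closedBall))).mul_right
  · exact (tsupport_mul_subset_left).trans (tsupport_ballCutoff_subset hR j)
  · rw [abs_mul]
    calc _ ≤ 1 * (L * R) := by gcongr; exacts [abs_ballCutoff_le_one R j x, hηle x hx]
      _ ≤ _ := by linarith
  · rw [hgrad]
    have hx' : ‖x‖ < R := by simpa using hx
    have h1 : ‖ballCutoff R j x • ∇ η x‖ ≤ L := by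
      rw [norm_smul]
      calc _ ≤ 1 * L := by
            gcongr
            exacts [abs_ballCutoff_le_one R j x, hL1 x (ball_subset_closedBall hx)]
        _ = L := one_mul L
    have h2 : ‖η x • ∇ (ballCutoff R j) x‖ ≤ 4 * M * L := by
      rw [gradient_ballCutoff, norm_smul, norm_smul, Real.norm_eq_abs, Real.norm_eq_abs]
      rcases lt_or_ge 1 (((j : ℝ) + 1) * (R ^ 2 - ‖x‖ ^ 2) - 1) with ht | ht
      · rw [deriv_smoothTransition_of_one_lt ht]
        simpa using hpos'
      · have h3 : ((j : ℝ) + 1) * (R * (R - ‖x‖)) ≤ 2 := by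
          have : R * (R - ‖x‖) ≤ R ^ 2 - ‖x‖ ^ 2 := by nlinarith [norm_nonneg x]
          have := mul_le_mul_of_nonneg_left this (by positivity : (0 : ℝ) ≤ j + 1)
          linarith
        have h4 := hL2 x (ball_subset_closedBall hx)
        rw [abs_mul, abs_mul, abs_neg, abs_of_pos (by positivity : (0 : ℝ) < j + 1), abs_two]
        calc _ ≤ L * (R - ‖x‖) * (2 * ((j + 1) * M) * R) := by
              gcongr
              exact hM _
          _ = 2 * M * L * ((j + 1) * (R * (R - ‖x‖))) := by ring
          _ ≤ 2 * M * L * 2 := by gcongr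
          _ = 4 * M * L := by ring
    calc _ ≤ L + 4 * M * L := (norm_add_le _ _).trans (add_le_add h1 h2)
      _ ≤ _ := by linarith
  · linarith [hηle x hx]
  · linarith [hL1 x (ball_subset_closedBall hx)]
  · refine tendsto_const_nhds.congr' ((eventually_one_lt_ballCutoff_arg hx).mono fun j hj => ?_)
    simp [ballCutoff, Real.smoothTransition.one_of_one_le hj.le]
  · refine tendsto_const_nhds.congr' ((eventually_one_lt_ballCutoff_arg hx).mono fun j hj => ?_)
    simp only [hgrad, gradient_ballCutoff, deriv_smoothTransition_of_one_lt hj]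
    simp [ballCutoff, Real.smoothTransition.one_of_one_le hj.le]

theorem hasH10GradientOn_ball [NeZero n] {R : ℝ} (hR : 0 < R)
    {η : EuclideanSpace ℝ (Fin n) → ℝ} (hη : ContDiff ℝ ∞ η)
    (h0 : ∀ x ∈ sphere (0 : EuclideanSpace ℝ (Fin n)) R, η x = 0) :
    HasH10GradientOn (ball 0 R) η (∇ η) := by
  obtain ⟨φ, C, hφ, hb, hbη, hlim⟩ := exists_testFunction_approx hR hη h0
  have hfin : IsFiniteMeasure (volume.restrict (ball (0 : EuclideanSpace ℝ (Fin n)) R)) :=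
    ⟨by simpa using measure_ball_lt_top⟩
  have hae : ∀ᵐ x ∂(volume.restrict (ball (0 : EuclideanSpace ℝ (Fin n)) R)), x ∈ ball 0 R :=
    ae_restrict_mem measurableSet_ball
  have hm := hη.continuous.aestronglyMeasurable
    (μ := volume.restrict (ball (0 : EuclideanSpace ℝ (Fin n)) R))
  have hgm := (continuous_gradient (contDiff_infty.1 hη 1)).aestronglyMeasurable
    (μ := volume.restrict (ball (0 : EuclideanSpace ℝ (Fin n)) R))
  refine ⟨MemLp.of_bound hm C (hae.mono fun x hx => (hbη x hx).1),
    MemLp.of_bound hgm C (hae.mono fun x hx => (hbη x hx).2), φ, hφ, ?_, ?_⟩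
  · exact tendsto_eLpNorm_two_of_bounded (C := C + C)
      (fun j => (hφ j).1.continuous.aestronglyMeasurable) hm
      (fun j => hae.mono fun x hx => (norm_sub_le _ _).trans
        (add_le_add (hb j x hx).1 (hbη x hx).1)) (hae.mono fun x hx => (hlim x hx).1)
  · exact tendsto_eLpNorm_two_of_bounded (C := C + C)
      (fun j => (continuous_gradient (contDiff_infty.1 (hφ j).1 1)).aestronglyMeasurable) hgm
      (fun j => hae.mono fun x hx => (norm_sub_le _ _).trans
        (add_le_add (hb j x hx).2 (hbη x hx).2)) (hae.mono fun x hx => (hlim x hx).2)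

theorem setIntegral_inner_gradient_eq_neg {D : Set (EuclideanSpace ℝ (Fin n))}
    {f φ : EuclideanSpace ℝ (Fin n) → ℝ} (hf : ContDiff ℝ 2 f) (hφ : IsTestFunctionOn D φ) :
    ∫ x in D, inner ℝ (∇ f x) (∇ φ x) = -∫ x in D, φ x * Δ f x := by
  rw [setIntegral_eq_integral_of_forall_compl_eq_zero, setIntegral_eq_integral_of_forall_compl_eq_zero,
    integral_inner_gradient_eq_neg hf (contDiff_infty.1 hφ.1 1) hφ.2.1]
  · intro x hx
    rw [image_eq_zero_of_notMem_tsupport fun h => hx (hφ.2.2 h), zero_mul]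
  · intro x hx
    rw [image_eq_zero_of_notMem_tsupport (f := ∇ φ)
      fun h => hx (hφ.2.2 (tsupport_gradient_subset φ h)), inner_zero_right]

/-- Green's identity for `u ∈ H^1_0(B_R)` against a function smooth on the whole space. -/
theorem HasH10GradientOn.integral_inner_gradient {R : ℝ} {u : EuclideanSpace ℝ (Fin n) → ℝ}
    {g : EuclideanSpace ℝ (Fin n) → EuclideanSpace ℝ (Fin n)}
    (hu : HasH10GradientOn (ball 0 R) u g) {η : EuclideanSpace ℝ (Fin n) → ℝ}
    (hη : ContDiff ℝ 2 η) :
    ∫ x in ball 0 R, inner ℝ (g x) (∇ η x) = -∫ x in ball 0 R, u x * Δ η x := by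
  obtain ⟨hu2, hg2, φ, hφ, h1, h2⟩ := hu
  have hfin : IsFiniteMeasure (volume.restrict (ball (0 : EuclideanSpace ℝ (Fin n)) R)) :=
    ⟨by simpa using measure_ball_lt_top⟩
  have hae : ∀ᵐ x ∂(volume.restrict (ball (0 : EuclideanSpace ℝ (Fin n)) R)), x ∈ ball 0 R :=
    ae_restrict_mem measurableSet_ball
  have hcg := continuous_gradient (hη.of_le (by norm_num : (1 : WithTop ℕ∞) ≤ 2))
  have hcl := continuous_laplacian hη
  obtain ⟨C1, hC1⟩ := (isCompact_closedBall (0 : EuclideanSpace ℝ (Fin n)) R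
    ).exists_bound_of_continuousOn hcg.continuousOn
  obtain ⟨C2, hC2⟩ := (isCompact_closedBall (0 : EuclideanSpace ℝ (Fin n)) R
    ).exists_bound_of_continuousOn hcl.continuousOn
  have l1 := tendsto_integral_inner_of_tendsto_eLpNorm
    (fun j => (Continuous.memLp_of_hasCompactSupport (p := 2) (μ := volume)
      (continuous_gradient (contDiff_infty.1 (hφ j).1 1))
      (hasCompactSupport_gradient (hφ j).2.1)).restrict (ball 0 R))
    hg2 hcg.aestronglyMeasurable (hae.mono fun x hx => hC1 x (ball_subset_closedBall hx)) h2
  have l2 := tendsto_integral_inner_of_tendsto_eLpNorm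
    (fun j => (Continuous.memLp_of_hasCompactSupport (p := 2) (μ := volume)
      (hφ j).1.continuous (hφ j).2.1).restrict (ball 0 R))
    hu2 hcl.aestronglyMeasurable (hae.mono fun x hx => hC2 x (ball_subset_closedBall hx)) h1
  have l3 := l2.neg
  refine tendsto_nhds_unique l1 ?_
  convert l3 using 2 with j
  · simp_rw [real_inner_comm]
    rw [setIntegral_inner_gradient_eq_neg hη (hφ j)]
    simp [mul_comm]
  · simp [mul_comm]

/-- The weak eigenvalue equation may be tested with smooth functions that merely vanish on the
boundary sphere. -/
theorem weak_equation_of_eq_zero_on_sphere [NeZero n] {R μ : ℝ} (hR : 0 < R)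
    {u : EuclideanSpace ℝ (Fin n) → ℝ} {g : EuclideanSpace ℝ (Fin n) → EuclideanSpace ℝ (Fin n)}
    (hu : MemLp u 2 (volume.restrict (ball 0 R))) (hg : MemLp g 2 (volume.restrict (ball 0 R)))
    (hw : ∀ φ : EuclideanSpace ℝ (Fin n) → ℝ, IsTestFunctionOn (ball 0 R) φ →
      ∫ x in ball 0 R, inner ℝ (g x) (∇ φ x) = μ * ∫ x in ball 0 R, u x * φ x)
    {η : EuclideanSpace ℝ (Fin n) → ℝ} (hη : ContDiff ℝ ∞ η)
    (h0 : ∀ x ∈ sphere (0 : EuclideanSpace ℝ (Fin n)) R, η x = 0) :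
    ∫ x in ball 0 R, inner ℝ (g x) (∇ η x) = μ * ∫ x in ball 0 R, u x * η x := by
  obtain ⟨φ, C, hφ, hb, hbη, hlim⟩ := exists_testFunction_approx hR hη h0
  have hfin : IsFiniteMeasure (volume.restrict (ball (0 : EuclideanSpace ℝ (Fin n)) R)) :=
    ⟨by simpa using measure_ball_lt_top⟩
  have hae : ∀ᵐ x ∂(volume.restrict (ball (0 : EuclideanSpace ℝ (Fin n)) R)), x ∈ ball 0 R :=
    ae_restrict_mem measurableSet_ball
  have l1 : Tendsto (fun j => ∫ x in ball 0 R, inner ℝ (g x) (∇ (φ j) x)) atTop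
      (𝓝 (∫ x in ball 0 R, inner ℝ (g x) (∇ η x))) := by
    refine tendsto_integral_of_dominated_convergence (fun x => ‖g x‖ * C)
      (fun j => hg.1.inner (continuous_gradient
        (contDiff_infty.1 (hφ j).1 1)).aestronglyMeasurable)
      ((hg.integrable (by norm_num)).norm.mul_const C)
      (fun j => hae.mono fun x hx => (norm_inner_le_norm _ _).trans ?_)
      (hae.mono fun x hx => tendsto_const_nhds.inner (hlim x hx).2)
    gcongr
    exact (hb j x hx).2
  have l2 : Tendsto (fun j => ∫ x in ball 0 R, u x * φ j x) atTop
      (𝓝 (∫ x in ball 0 R, u x * η x)) := by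
    refine tendsto_integral_of_dominated_convergence (fun x => ‖u x‖ * C)
      (fun j => hu.1.mul (hφ j).1.continuous.aestronglyMeasurable)
      ((hu.integrable (by norm_num)).norm.mul_const C)
      (fun j => hae.mono fun x hx => ?_)
      (hae.mono fun x hx => tendsto_const_nhds.mul (hlim x hx).1)
    rw [norm_mul]
    gcongr
    exact (hb j x hx).1
  refine tendsto_nhds_unique l1 ((l2.const_mul μ).congr fun j => (hw _ (hφ j)).symm)

end H10

/-! ### Radial eigenfunctions and zeros of the Bessel function -/

section Radial

variable {n : ℕ}

/-- A radial integrable function on a ball all of whose even radial moments vanish is zero. -/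
theorem ae_eq_zero_of_radial_moments_eq_zero {R : ℝ} {w : EuclideanSpace ℝ (Fin n) → ℝ}
    (hw : Integrable w (volume.restrict (ball 0 R))) (hrad : IsRadialOn (ball 0 R) w)
    (hmom : ∀ j : ℕ, ∫ x in ball 0 R, w x * (‖x‖ ^ 2) ^ j = 0) :
    ∀ᵐ x ∂(volume.restrict (ball 0 R)), w x = 0 := by
  obtain ⟨h, hh, hwh⟩ := hrad
  set ρ := volume.restrict (ball (0 : EuclideanSpace ℝ (Fin n)) R)
  have hae : ∀ᵐ x ∂ρ, x ∈ ball 0 R := ae_restrict_mem measurableSet_ball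
  have hnorm : Measurable fun x : EuclideanSpace ℝ (Fin n) => ‖x‖ := measurable_norm
  have hint : Integrable h (ρ.map fun x => ‖x‖) :=
    (integrable_map_measure hh.aestronglyMeasurable hnorm.aemeasurable).2 (hw.congr hwh)
  have hpow : ∀ j : ℕ, Integrable (fun x => w x * (‖x‖ ^ 2) ^ j) ρ := fun j => by
    refine (hw.norm.mul_const ((R ^ 2) ^ j)).mono' (hw.1.mul (by fun_prop)) (hae.mono fun x hx => ?_)
    have hx' : ‖x‖ ≤ R := (mem_ball_zero_iff.1 hx).le
    rw [norm_mul, norm_pow, norm_pow, norm_norm]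
    gcongr
  have hpoly : ∀ p : Polynomial ℝ, Integrable (fun x => w x * p.eval (‖x‖ ^ 2)) ρ ∧
      ∫ x, w x * p.eval (‖x‖ ^ 2) ∂ρ = 0 := fun p => by
    have e : (fun x => w x * p.eval (‖x‖ ^ 2)) =
        fun x => ∑ i ∈ Finset.range (p.natDegree + 1), p.coeff i * (w x * (‖x‖ ^ 2) ^ i) := by
      funext x
      rw [Polynomial.eval_eq_sum_range, Finset.mul_sum]
      exact Finset.sum_congr rfl fun i _ => by ring
    rw [e]
    refine ⟨integrable_finsetSum _ fun i _ => (hpow i).const_mul _, ?_⟩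
    rw [integral_finsetSum _ fun i _ => (hpow i).const_mul _]
    exact Finset.sum_eq_zero fun i _ => by rw [integral_const_mul, hmom, mul_zero]
  -- The profile `h` is shown to vanish almost everywhere for the law of `‖x‖`, by pairing it with
  -- test functions on the line.
  have hzero := ae_eq_zero_of_integral_contDiff_smul_eq_zero hint.locallyIntegrable
    fun φ hφ hc => by
      have hI : ∫ r, φ r • h r ∂(ρ.map fun x => ‖x‖) = ∫ x, w x * φ ‖x‖ ∂ρ := by
        rw [integral_map (f := fun r => φ r • h r) hnorm.aemeasurable
          (hφ.continuous.measurable.mul hh).aestronglyMeasurable]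
        refine integral_congr_ae (hwh.mono fun x hx => ?_)
        simp [hx, mul_comm]
      rw [hI, ← norm_le_zero_iff]
      obtain ⟨C, hC⟩ := hc.exists_bound_of_continuous hφ.continuous
      have hφi : Integrable (fun x => w x * φ ‖x‖) ρ :=
        (hw.norm.mul_const C).mono' (hw.1.mul (hφ.continuous.comp
          continuous_norm).aestronglyMeasurable) (Eventually.of_forall fun x => by
            rw [norm_mul]; gcongr; exact hC _)
      have hK : 0 ≤ ∫ x, ‖w x‖ ∂ρ := integral_nonneg fun x => norm_nonneg _
      refine le_of_forall_pos_le_add fun ε hε => ?_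
      -- Weierstrass is applied to `φ(√t)` on `[0, R²]`, so that the approximant is a polynomial in
      -- `‖x‖²` and only even moments occur.
      obtain ⟨p, hp⟩ := exists_polynomial_near_of_continuousOn 0 (R ^ 2) (fun t => φ (Real.sqrt t))
        (hφ.continuous.comp Real.continuous_sqrt).continuousOn (ε / (∫ x, ‖w x‖ ∂ρ + 1))
        (by positivity)
      calc ‖∫ x, w x * φ ‖x‖ ∂ρ‖
          = ‖∫ x, w x * (φ ‖x‖ - p.eval (‖x‖ ^ 2)) ∂ρ‖ := by
            simp only [mul_sub]
            rw [integral_sub hφi (hpoly p).1, (hpoly p).2, sub_zero]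
        _ ≤ ∫ x, ‖w x‖ * (ε / (∫ x, ‖w x‖ ∂ρ + 1)) ∂ρ := by
            refine norm_integral_le_of_norm_le (hw.norm.mul_const _) (hae.mono fun x hx => ?_)
            have hx' : ‖x‖ ≤ R := (mem_ball_zero_iff.1 hx).le
            have := hp (‖x‖ ^ 2) ⟨by positivity, by gcongr⟩
            rw [Real.sqrt_sq (norm_nonneg x), abs_sub_comm] at this
            rw [norm_mul]
            gcongr
            exact this.le
        _ ≤ 0 + ε := by
            rw [integral_mul_const, mul_div_assoc', div_le_iff₀ (by positivity)]
            nlinarith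
  filter_upwards [hwh, ae_of_ae_map hnorm.aemeasurable hzero] with x hx hx0
  rw [hx, hx0]

theorem finrank_eq_two_mul_add_two (n : ℕ) :
    (Module.finrank ℝ (EuclideanSpace ℝ (Fin n)) : ℝ) = 2 * (((n : ℝ) - 2) / 2) + 2 := by
  rw [finrank_euclideanSpace_fin]
  ring

/-- Moments replace both boundary regularity and uniqueness for the radial equation. With `m_j = ∫ w
|x|^(2j)`, the identity `∫ w (Δf + k² f) = 0` gives `k² m_0 = 0` for `f = 1`, and expresses `k²
m_{j+1}` as a multiple of `m_j` for `f = |x|^(2j+2)`. -/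
theorem besselEntire_eq_zero_of_radial_eigenfunction (hn : 2 ≤ n) {R k : ℝ} (hR : 0 < R)
    (hk : 0 < k) {w : EuclideanSpace ℝ (Fin n) → ℝ}
    (hw : IsDirichletEigenfunction (ball 0 R) (k ^ 2) w) (hrad : IsRadialOn (ball 0 R) w) :
    besselEntire (((n : ℝ) - 2) / 2) ((k * R) ^ 2) = 0 := by
  have : NeZero n := ⟨by omega⟩
  have hn' : (2 : ℝ) ≤ n := by exact_mod_cast hn
  set ν : ℝ := ((n : ℝ) - 2) / 2
  have hν : 0 ≤ ν := by simp only [ν]; linarith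
  by_contra hne
  obtain ⟨hw0, g, hg, hweak⟩ := hw
  have hfin : IsFiniteMeasure (volume.restrict (ball (0 : EuclideanSpace ℝ (Fin n)) R)) :=
    ⟨by simpa using measure_ball_lt_top⟩
  have hae : ∀ᵐ x ∂(volume.restrict (ball (0 : EuclideanSpace ℝ (Fin n)) R)), x ∈ ball 0 R :=
    ae_restrict_mem measurableSet_ball
  have hwi : Integrable w (volume.restrict (ball 0 R)) := hg.1.integrable (by norm_num)
  have hmulint : ∀ f : EuclideanSpace ℝ (Fin n) → ℝ, Continuous f →
      Integrable (fun x => w x * f x) (volume.restrict (ball 0 R)) := fun f hf => by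
    obtain ⟨C, hC⟩ := (isCompact_closedBall (0 : EuclideanSpace ℝ (Fin n)) R
      ).exists_bound_of_continuousOn hf.continuousOn
    refine (hwi.norm.mul_const C).mono' (hwi.1.mul hf.aestronglyMeasurable)
      (hae.mono fun x hx => ?_)
    rw [norm_mul]
    gcongr
    exact hC x (ball_subset_closedBall hx)
  have hψ := contDiff_radialBessel (E := EuclideanSpace ℝ (Fin n)) hν k
  have key : ∀ f : EuclideanSpace ℝ (Fin n) → ℝ, ContDiff ℝ ∞ f → ∀ c : ℝ,
      (∀ x ∈ sphere (0 : EuclideanSpace ℝ (Fin n)) R, f x = c) →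
      ∫ x in ball 0 R, w x * (Δ f x + k ^ 2 * f x) = 0 := fun f hf c hc => by
    -- Dividing by the boundary value of `ψ` is where the assumption that it is nonzero enters. The
    -- correction `dψ` contributes nothing to `Δ + k²`.
    set d : ℝ := c / besselEntire ν ((k * R) ^ 2)
    set η : EuclideanSpace ℝ (Fin n) → ℝ := f - d • (radialBessel ν k)
    have hη : ContDiff ℝ ∞ η := hf.sub (hψ.const_smul d)
    have hη0 : ∀ x ∈ sphere (0 : EuclideanSpace ℝ (Fin n)) R, η x = 0 := fun x hx => by
      have hx' : ‖x‖ = R := by simpa using hx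
      simp only [η, d, Pi.sub_apply, Pi.smul_apply, smul_eq_mul, hc x hx, radialBessel, hx',
        ← mul_pow]
      rw [div_mul_cancel₀ _ hne, sub_self]
    -- Two evaluations of `∫ g·∇η`: the weak equation, as `η` vanishes on the sphere, and Green's
    -- identity, as `w` is in `H^1_0`.
    have h1 := weak_equation_of_eq_zero_on_sphere hR hg.1 hg.2.1 hweak hη hη0
    have h2 := hg.integral_inner_gradient (contDiff_infty.1 hη 2)
    have hΔ : ∀ x, Δ η x = Δ f x - d * (-k ^ 2 * radialBessel ν k x) := fun x => by
      have hs : ContDiffAt ℝ 2 (d • (radialBessel ν k : EuclideanSpace ℝ (Fin n) → ℝ)) x :=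
        (contDiff_infty.1 (hψ.const_smul d) 2).contDiffAt
      rw [ContDiffAt.laplacian_sub (contDiff_infty.1 hf 2).contDiffAt hs,
        InnerProductSpace.laplacian_smul _ (contDiff_infty.1 hψ 2).contDiffAt,
        laplacian_radialBessel hν (finrank_eq_two_mul_add_two n), smul_eq_mul]
    have e : ∀ x, w x * (Δ f x + k ^ 2 * f x) = w x * Δ η x + k ^ 2 * (w x * η x) := fun x => by
      rw [hΔ]
      simp only [η, Pi.sub_apply, Pi.smul_apply, smul_eq_mul]
      ring
    simp only [e]
    rw [integral_add (hmulint _ (continuous_laplacian (contDiff_infty.1 hη 2)))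
      ((hmulint _ hη.continuous).const_mul _), integral_const_mul]
    linarith
  refine hw0 (ae_eq_zero_of_radial_moments_eq_zero hwi hrad fun j => ?_)
  have hsm : ∀ j : ℕ, ContDiff ℝ ∞ fun x : EuclideanSpace ℝ (Fin n) => (‖x‖ ^ 2) ^ j := fun j =>
    (contDiff_norm_sq ℝ).pow j
  have hsph : ∀ j : ℕ, ∀ x ∈ sphere (0 : EuclideanSpace ℝ (Fin n)) R,
      (‖x‖ ^ 2) ^ j = (R ^ 2) ^ j := fun j x hx => by
    rw [mem_sphere_zero_iff_norm.1 hx]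
  have hk2 : k ^ 2 ≠ 0 := by positivity
  induction j with
  | zero =>
    have h := key (fun _ => 1) contDiff_const 1 fun _ _ => rfl
    have e : Δ (fun _ : EuclideanSpace ℝ (Fin n) => (1 : ℝ)) = 0 :=
      InnerProductSpace.laplacian_const
    simp only [e, Pi.zero_apply, zero_add, mul_one] at h
    rw [integral_mul_const] at h
    simpa using (mul_eq_zero.1 h).resolve_right hk2
  | succ j ih =>
    have h := key _ (hsm (j + 1)) _ (hsph (j + 1))
    set a : ℝ := 2 * (j + 1) * (2 * j + Module.finrank ℝ (EuclideanSpace ℝ (Fin n)))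
    have e : ∀ x : EuclideanSpace ℝ (Fin n),
        w x * (Δ (fun y : EuclideanSpace ℝ (Fin n) => (‖y‖ ^ 2) ^ (j + 1)) x +
          k ^ 2 * (‖x‖ ^ 2) ^ (j + 1)) =
        a * (w x * (‖x‖ ^ 2) ^ j) + k ^ 2 * (w x * (‖x‖ ^ 2) ^ (j + 1)) := fun x => by
      rw [laplacian_norm_sq_pow]
      ring
    simp only [e] at h
    rw [integral_add ((hmulint _ (hsm j).continuous).const_mul _)
      ((hmulint _ (hsm (j + 1)).continuous).const_mul _), integral_const_mul,
      integral_const_mul, ih, mul_zero, zero_add] at h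
    exact (mul_eq_zero.1 h).resolve_left hk2

theorem radialBessel_isDirichletEigenfunction (hn : 2 ≤ n) {R k : ℝ} (hR : 0 < R)
    (h0 : besselEntire (((n : ℝ) - 2) / 2) ((k * R) ^ 2) = 0) :
    IsDirichletEigenfunction (ball (0 : EuclideanSpace ℝ (Fin n)) R) (k ^ 2)
      (radialBessel (((n : ℝ) - 2) / 2) k) ∧
    IsRadialOn (ball (0 : EuclideanSpace ℝ (Fin n)) R) (radialBessel (((n : ℝ) - 2) / 2) k) := by
  have : NeZero n := ⟨by omega⟩
  have hn' : (2 : ℝ) ≤ n := by exact_mod_cast hn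
  have hE := finrank_eq_two_mul_add_two n
  set ν : ℝ := ((n : ℝ) - 2) / 2
  have hν : 0 ≤ ν := by simp only [ν]; linarith
  have hψ := contDiff_radialBessel (E := EuclideanSpace ℝ (Fin n)) hν k
  refine ⟨⟨fun hae => ?_, ∇ (radialBessel ν k), hasH10GradientOn_ball hR hψ fun x hx => ?_,
    fun φ hφ => ?_⟩, fun r => besselEntire ν (k ^ 2 * r ^ 2), ?_, Eventually.of_forall fun x => rfl⟩
  · have h := Measure.eqOn_open_of_ae_eq (f := radialBessel ν k) (g := fun _ => 0) hae isOpen_ball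
      hψ.continuous.continuousOn continuousOn_const (mem_ball_self hR)
    simp only [radialBessel, norm_zero] at h
    have := besselEntire_zero_pos hν
    norm_num at h
    linarith
  · rw [radialBessel, mem_sphere_zero_iff_norm.1 hx, ← mul_pow, h0]
  · rw [setIntegral_inner_gradient_eq_neg (contDiff_infty.1 hψ 2) hφ, ← integral_neg,
      ← integral_const_mul]
    congr 1 with x
    rw [laplacian_radialBessel hν hE]
    ring
  · exact (((contDiff_besselEntire hν).continuous).comp (by fun_prop)).measurable

end Radial

/-! ### Polar coordinates and localization to a sphere -/

section Polar

variable {E : Type*} [NormedAddCommGroup E] [InnerProductSpace ℝ E] [FiniteDimensional ℝ E]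
  [MeasurableSpace E] [BorelSpace E]

theorem integrable_sphere_of_continuous {F : Type*} [NormedAddCommGroup F]
    {f : sphere (0 : E) 1 → F} (hf : Continuous f) :
    Integrable f (volume : Measure E).toSphere :=
  hf.integrable_of_hasCompactSupport (HasCompactSupport.of_compactSpace f)

theorem continuous_integral_smul_sphere {V : E → ℝ} (hV : Continuous V) :
    Continuous fun r : ℝ => ∫ θ : sphere (0 : E) 1, V (r • (θ : E))
      ∂(volume : Measure E).toSphere := by
  have h := continuous_parametric_integral_of_continuous (μ := (volume : Measure E).toSphere)
    (f := fun (r : ℝ) (θ : sphere (0 : E) 1) => V (r • (θ : E)))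
    (by simp only [Function.uncurry_def]; fun_prop) (isCompact_univ)
  simpa using h

variable [Nontrivial E]

theorem integral_eq_integral_volumeIoiPow_toSphere {f : E → ℝ} (hf : Integrable f) :
    ∫ x, f x = ∫ r : Set.Ioi (0 : ℝ), ∫ θ : sphere (0 : E) 1, f ((r : ℝ) • (θ : E))
      ∂(volume : Measure E).toSphere ∂(Measure.volumeIoiPow (Module.finrank ℝ E - 1)) := by
  have hmp := (volume : Measure E).measurePreserving_homeomorphUnitSphereProd
  have hemb := (homeomorphUnitSphereProd E).measurableEmbedding
  set F : sphere (0 : E) 1 × Set.Ioi (0 : ℝ) → ℝ := fun p => f ((p.2 : ℝ) • (p.1 : E))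
  have hFx : ∀ x : ({(0)}ᶜ : Set E), F (homeomorphUnitSphereProd E x) = f x := fun x => by
    have hx : ‖(x : E)‖ ≠ 0 := norm_ne_zero_iff.2 x.2
    simp only [F, homeomorphUnitSphereProd_apply_snd_coe, homeomorphUnitSphereProd_apply_fst_coe]
    rw [smul_inv_smul₀ hx]
  have hint : Integrable F ((volume : Measure E).toSphere.prod
      (Measure.volumeIoiPow (Module.finrank ℝ E - 1))) := by
    rw [← hmp.integrable_comp_emb hemb]
    have h1 : Integrable f (volume.restrict ({(0)}ᶜ : Set E)) := hf.restrict
    have h2 := (integrableOn_iff_comap_subtypeVal (measurableSet_singleton (0 : E)).compl).1 h1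
    exact h2.congr (Eventually.of_forall fun x => (hFx x).symm)
  calc ∫ x, f x = ∫ x : ({(0)}ᶜ : Set E), f x ∂(volume.comap Subtype.val) := by
        rw [integral_subtype_comap (measurableSet_singleton _).compl f,
          restrict_compl_singleton]
    _ = ∫ x : ({(0)}ᶜ : Set E), F (homeomorphUnitSphereProd E x) ∂(volume.comap Subtype.val) := by
        simp only [hFx]
    _ = ∫ p, F p ∂((volume : Measure E).toSphere.prod
          (Measure.volumeIoiPow (Module.finrank ℝ E - 1))) := hmp.integral_comp hemb F
    _ = _ := integral_prod_symm F hint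

theorem toSphere_real_univ_pos : 0 < (volume : Measure E).toSphere.real Set.univ := by
  rw [Measure.toSphere_real_apply_univ]
  have : 0 < (volume : Measure E).real (ball 0 1) :=
    ENNReal.toReal_pos (measure_ball_pos _ _ one_pos).ne' measure_ball_lt_top.ne
  have h2 : 0 < Module.finrank ℝ E := Module.finrank_pos
  positivity

/-- If the spherical integral `N(r)` of `V` were positive at `R`, it would exceed `N(R)/2` on a thin
shell. Polar coordinates would then give `∫ q (V - m) ≥ 0` for a weight `q` supported there, whereas
`∫ qV = 0` makes this `-m ∫ q < 0`. Applied to `V` and `-V`, this turns volume identities into a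
surface identity. -/
theorem integral_sphere_nonpos_of_localized {V : E → ℝ} (hV : Continuous V) {R : ℝ} (hR : 0 < R)
    (hq : ∀ δ > 0, δ < R → ∃ q : ℝ → ℝ, Continuous q ∧ (∀ r, 0 ≤ q r) ∧
      (∀ r, 0 ≤ r → q r ≠ 0 → |r - R| ≤ δ) ∧ (∃ r, 0 ≤ r ∧ q r ≠ 0) ∧
      ∫ x, q ‖x‖ * V x = 0) :
    ∫ θ : sphere (0 : E) 1, V (R • (θ : E)) ∂(volume : Measure E).toSphere ≤ 0 := by
  set σ := (volume : Measure E).toSphere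
  set N : ℝ → ℝ := fun r => ∫ θ : sphere (0 : E) 1, V (r • (θ : E)) ∂σ
  have hN : Continuous N := continuous_integral_smul_sphere hV
  by_contra! hpos
  have hpos' : 0 < N R := hpos
  obtain ⟨ε, hε, hball⟩ := Metric.eventually_nhds_iff.1
    (hN.continuousAt.eventually (lt_mem_nhds (half_lt_self hpos')))
  obtain ⟨q, hqc, hq0, hqs, ⟨r0, hr0, hqr0⟩, hqV⟩ := hq (min (ε / 2) (R / 2)) (by positivity)
    ((min_le_right _ _).trans_lt (half_lt_self hR))
  have hcs : HasCompactSupport fun x : E => q ‖x‖ := by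
    refine HasCompactSupport.of_support_subset_isCompact (isCompact_closedBall (0 : E) (R + R))
      fun x hx => ?_
    have h1 := hqs ‖x‖ (norm_nonneg x) hx
    have h2 := (abs_le.1 h1).2
    have h3 := min_le_right (ε / 2) (R / 2)
    rw [mem_closedBall_zero_iff]
    linarith
  have hqn : Continuous fun x : E => q ‖x‖ := hqc.comp continuous_norm
  have hσ : 0 < σ.real Set.univ := toSphere_real_univ_pos
  -- Normalized so that the constant `m` has spherical integral `N R / 2`.
  set m : ℝ := N R / 2 / σ.real Set.univ
  have hm : 0 < m := by positivity
  have i1 : Integrable fun x : E => q ‖x‖ * V x :=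
    (hqn.mul hV).integrable_of_hasCompactSupport hcs.mul_right
  have i2 : Integrable fun x : E => q ‖x‖ := hqn.integrable_of_hasCompactSupport hcs
  have hqpos : 0 < ∫ x : E, q ‖x‖ := by
    obtain ⟨x, hx⟩ := exists_norm_eq E hr0
    exact hqn.integral_pos_of_hasCompactSupport_nonneg_nonzero hcs (fun x => hq0 _)
      (x := x) (by rwa [hx])
  have hlhs : ∫ x : E, (q ‖x‖ * V x - q ‖x‖ * m) = -((∫ x : E, q ‖x‖) * m) := by
    rw [integral_sub i1 (i2.mul_const m), hqV, integral_mul_const, zero_sub]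
  have hrhs : 0 ≤ ∫ x : E, (q ‖x‖ * V x - q ‖x‖ * m) := by
    rw [integral_eq_integral_volumeIoiPow_toSphere (f := fun x => q ‖x‖ * V x - q ‖x‖ * m)
      (i1.sub (i2.mul_const m))]
    refine integral_nonneg fun r => ?_
    have hr : (0 : ℝ) < r := r.2
    have hnorm : ∀ θ : sphere (0 : E) 1, ‖(r : ℝ) • (θ : E)‖ = r := fun θ => by
      rw [norm_smul, Real.norm_of_nonneg hr.le, norm_eq_of_mem_sphere, mul_one]
    have hVi : Integrable (fun θ : sphere (0 : E) 1 => V ((r : ℝ) • (θ : E))) σ :=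
      integrable_sphere_of_continuous (by fun_prop)
    simp only [hnorm, ← mul_sub, Pi.zero_apply]
    rw [integral_const_mul, integral_sub hVi (integrable_const m), integral_const, smul_eq_mul]
    by_cases hqr : q r = 0
    · simp [hqr]
    · have h1 := hqs r hr.le hqr
      have h2 := min_le_left (ε / 2) (R / 2)
      have h3 : N R / 2 < N r := hball (by rw [Real.dist_eq]; linarith)
      have h4 : σ.real Set.univ * m = N R / 2 := by simp only [m]; field_simp
      rw [h4]
      exact mul_nonneg (hq0 _) (sub_nonneg.2 h3.le)
  rw [hlhs] at hrhs
  have := mul_pos hqpos hm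
  linarith

end Polar

/-! ### Green's second identity on a sphere and the mean-zero property -/

section Green

variable {E : Type*} [NormedAddCommGroup E] [InnerProductSpace ℝ E] [FiniteDimensional ℝ E]

theorem laplacian_comp_inner {G G' G'' : ℝ → ℝ} (hG : ContDiff ℝ 2 G)
    (h1 : ∀ t, HasDerivAt G (G' t) t) (h2 : ∀ t, HasDerivAt G' (G'' t) t) (z x : E) :
    Δ (fun y : E => G (inner ℝ y z)) x = ‖z‖ ^ 2 * G'' (inner ℝ x z) := by
  have hi : ∀ y, HasFDerivAt (fun y : E => inner ℝ y z) (innerSL ℝ z) y := fun y => by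
    simpa [real_inner_comm] using (innerSL ℝ z).hasFDerivAt (x := y)
  have hsm : ContDiff ℝ 2 fun y : E => G (inner ℝ y z) :=
    hG.comp (contDiff_id.inner ℝ contDiff_const)
  rw [laplacian_eq_sum_fderiv_fderiv hsm]
  have e1 : ∀ v : E, (fun y : E => fderiv ℝ (fun y : E => G (inner ℝ y z)) y v) =
      fun y => inner ℝ z v * G' (inner ℝ y z) := fun v => funext fun y => by
    have h := ((h1 _).comp_hasFDerivAt y (hi y)).fderiv
    have h' := congrArg (fun L : E →L[ℝ] ℝ => L v) h
    simpa [Function.comp_def, mul_comm] using h'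
  have e2 : ∀ v : E, fderiv ℝ (fun y : E => inner ℝ z v * G' (inner ℝ y z)) x v =
      inner ℝ z v ^ 2 * G'' (inner ℝ x z) := fun v => by
    have h := (((h2 _).comp_hasFDerivAt x (hi x)).const_mul (inner ℝ z v)).fderiv
    have h' := congrArg (fun L : E →L[ℝ] ℝ => L v) h
    refine Eq.trans (by simpa [Function.comp_def] using h') ?_
    ring
  simp only [e1, e2, ← Finset.sum_mul, OrthonormalBasis.sum_sq_inner_left]

variable [MeasurableSpace E] [BorelSpace E]

/-- Green's second identity, for two solutions of the same Helmholtz equation, tested against a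
compactly supported function. -/
theorem integral_inner_wronskian_gradient_eq_zero {u ψ χ : E → ℝ} {lam : ℝ} (hu : ContDiff ℝ 2 u)
    (hψ : ContDiff ℝ 2 ψ) (hue : ∀ x, Δ u x = lam * u x) (hψe : ∀ x, Δ ψ x = lam * ψ x)
    (hχ : ContDiff ℝ 1 χ) (hc : HasCompactSupport χ) :
    ∫ x, inner ℝ (ψ x • ∇ u x - u x • ∇ ψ x) (∇ χ x) = 0 := by
  have hu1 : ContDiff ℝ 1 u := hu.of_le (by norm_num)
  have hψ1 : ContDiff ℝ 1 ψ := hψ.of_le (by norm_num)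
  have hmul : ∀ f : E → ℝ, ContDiff ℝ 1 f → ∀ x,
      ∇ (fun y => f y * χ y) x = f x • ∇ χ x + χ x • ∇ f x := fun f hf x =>
    gradient_mul (hf.differentiable (by norm_num) x) (hχ.differentiable (by norm_num) x)
  have hcu : HasCompactSupport fun y => u y * χ y := hc.mul_left
  have hcψ : HasCompactSupport fun y => ψ y * χ y := hc.mul_left
  have h1 := integral_inner_gradient_eq_neg hu (hψ1.mul hχ) hcψ
  have h2 := integral_inner_gradient_eq_neg hψ (hu1.mul hχ) hcu
  -- The terms `χ ∇u·∇ψ` cancel, leaving the Wronskian field against `∇χ`.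
  have e : ∀ x, inner ℝ (ψ x • ∇ u x - u x • ∇ ψ x) (∇ χ x) =
      inner ℝ (∇ u x) (∇ (fun y => ψ y * χ y) x) -
        inner ℝ (∇ ψ x) (∇ (fun y => u y * χ y) x) := fun x => by
    rw [hmul ψ hψ1, hmul u hu1]
    simp only [inner_sub_left, inner_add_right, inner_smul_left, inner_smul_right,
      real_inner_comm (∇ ψ x) (∇ u x)]
    simp
  simp only [e]
  have hint : ∀ f g : E → ℝ, ContDiff ℝ 1 f → ContDiff ℝ 1 g → HasCompactSupport g →
      Integrable fun x => inner ℝ (∇ f x) (∇ g x) := fun f g hf hg hgc =>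
    ((continuous_gradient hf).inner (continuous_gradient hg)).integrable_of_hasCompactSupport
      ((hasCompactSupport_gradient hgc).mono fun x hx => by
        contrapose! hx
        simp only [Function.mem_support, not_not] at hx ⊢
        rw [hx, inner_zero_right])
  rw [integral_sub (hint _ _ hu1 (hψ1.mul hχ) hcψ) (hint _ _ hψ1 (hu1.mul hχ) hcu), h1, h2,
    sub_eq_zero]
  congr 2 with x
  rw [hue, hψe]
  ring

theorem exists_deriv_smoothTransition_ne_zero :
    ∃ t ∈ Set.Ioo (0 : ℝ) 1, deriv Real.smoothTransition t ≠ 0 := by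
  obtain ⟨t, ht, h⟩ := exists_deriv_eq_slope Real.smoothTransition (zero_lt_one' ℝ)
    Real.smoothTransition.continuous.continuousOn
    ((Real.smoothTransition.contDiff (n := 1)).differentiable (by norm_num)).differentiableOn
  refine ⟨t, ht, ?_⟩
  rw [h]
  simp

/-- Test the Wronskian identity with a radial cutoff that drops from 1 to 0 across a thin shell
about the sphere: its gradient is radial with one sign, so it supplies the weights for localization.
-/
theorem integral_sphere_wronskian_eq_zero [Nontrivial E] {u ψ : E → ℝ} {lam R : ℝ} (hR : 0 < R)
    (hu : ContDiff ℝ 2 u) (hψ : ContDiff ℝ 2 ψ) (hue : ∀ x, Δ u x = lam * u x)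
    (hψe : ∀ x, Δ ψ x = lam * ψ x) :
    ∫ θ : sphere (0 : E) 1, inner ℝ (ψ (R • (θ : E)) • ∇ u (R • (θ : E)) -
      u (R • (θ : E)) • ∇ ψ (R • (θ : E))) (R • (θ : E)) ∂(volume : Measure E).toSphere = 0 := by
  set S' := deriv Real.smoothTransition
  have hS : ContDiff ℝ ∞ Real.smoothTransition := Real.smoothTransition.contDiff
  have hS'c : Continuous S' := (contDiff_infty.1 hS 1).continuous_deriv (by norm_num)
  have hSd : ∀ t, HasDerivAt Real.smoothTransition (S' t) t := fun t =>
    (hS.differentiable (by simp) t).hasDerivAt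
  set V : E → ℝ := fun x => inner ℝ (ψ x • ∇ u x - u x • ∇ ψ x) x
  have hV : Continuous V := by
    have := continuous_gradient (hu.of_le (by norm_num : (1 : WithTop ℕ∞) ≤ 2))
    have := continuous_gradient (hψ.of_le (by norm_num : (1 : WithTop ℕ∞) ≤ 2))
    have := hu.continuous
    have := hψ.continuous
    fun_prop
  have hq : ∀ δ > 0, δ < R → ∃ q : ℝ → ℝ, Continuous q ∧ (∀ r, 0 ≤ q r) ∧
      (∀ r, 0 ≤ r → q r ≠ 0 → |r - R| ≤ δ) ∧ (∃ r, 0 ≤ r ∧ q r ≠ 0) ∧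
      ∫ x, q ‖x‖ * V x = 0 := fun δ hδ hδR => by
    -- The shell is `|r² - R²| ≤ d`. Since `|r² - R²| ≥ R |r - R|`, the choice `d = δR` forces `|r -
    -- R| ≤ δ`.
    set d : ℝ := δ * R
    have hd : 0 < d := by positivity
    have hdR : d ≤ R ^ 2 := by simp only [d]; nlinarith
    refine ⟨fun r => S' ((R ^ 2 + d - r ^ 2) / (2 * d)), by fun_prop, fun r =>
      Real.smoothTransition.monotone.deriv_nonneg, fun r hr hqr => ?_, ?_, ?_⟩
    · have h1 : 0 ≤ (R ^ 2 + d - r ^ 2) / (2 * d) := by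
        by_contra! h
        exact hqr (deriv_smoothTransition_of_neg h)
      have h2 : (R ^ 2 + d - r ^ 2) / (2 * d) ≤ 1 := by
        by_contra! h
        exact hqr (deriv_smoothTransition_of_one_lt h)
      rw [le_div_iff₀ (by positivity)] at h1
      rw [div_le_iff₀ (by positivity)] at h2
      simp only [d] at h1 h2
      rw [abs_le]
      constructor <;> nlinarith
    · obtain ⟨t, ht, hne⟩ := exists_deriv_smoothTransition_ne_zero
      have h0 : 0 ≤ R ^ 2 + d - 2 * d * t := by nlinarith [ht.1, ht.2]
      refine ⟨Real.sqrt (R ^ 2 + d - 2 * d * t), Real.sqrt_nonneg _, ?_⟩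
      simp only
      rw [Real.sq_sqrt h0]
      have : (R ^ 2 + d - (R ^ 2 + d - 2 * d * t)) / (2 * d) = t := by field_simp; ring
      rwa [this]
    · set G : ℝ → ℝ := fun t => Real.smoothTransition ((R ^ 2 + d - t) / (2 * d))
      have hG : ContDiff ℝ ∞ G := hS.comp ((contDiff_const.sub contDiff_id).div_const _)
      have hGd : ∀ t, HasDerivAt G (-(1 / (2 * d)) * S' ((R ^ 2 + d - t) / (2 * d))) t := fun t => by
        have hl : HasDerivAt (fun t : ℝ => (R ^ 2 + d - t) / (2 * d)) (-1 / (2 * d)) t :=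
          ((hasDerivAt_id t).const_sub _).div_const _
        exact ((hSd _).comp t hl).congr_deriv (by ring)
      have hχc : HasCompactSupport fun x : E => G (‖x‖ ^ 2) := by
        refine HasCompactSupport.of_support_subset_isCompact
          (isCompact_closedBall (0 : E) (R + R)) fun x hx => ?_
        by_contra h
        rw [mem_closedBall_zero_iff, not_le] at h
        refine hx (Real.smoothTransition.zero_of_nonpos (div_nonpos_of_nonpos_of_nonneg ?_
          (by positivity)))
        nlinarith
      have h := integral_inner_wronskian_gradient_eq_zero hu hψ hue hψe
        (contDiff_infty.1 (contDiff_comp_norm_sq (E := E) hG) 1) hχc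
      have e : ∀ x : E, inner ℝ (ψ x • ∇ u x - u x • ∇ ψ x) (∇ (fun x : E => G (‖x‖ ^ 2)) x) =
          -(1 / d) * (S' ((R ^ 2 + d - ‖x‖ ^ 2) / (2 * d)) * V x) := fun x => by
        rw [(hasGradientAt_comp_norm_sq (hGd _)).gradient, inner_smul_right]
        simp only [V]
        field_simp
      simp only [e] at h
      rw [integral_const_mul] at h
      exact (mul_eq_zero.1 h).resolve_left (by simpa using hd.ne')
  refine le_antisymm (integral_sphere_nonpos_of_localized hV hR hq) ?_
  have h := integral_sphere_nonpos_of_localized hV.neg hR fun δ hδ hδR => by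
    obtain ⟨q, h1, h2, h3, h4, h5⟩ := hq δ hδ hδR
    exact ⟨q, h1, h2, h3, h4, by simp [integral_neg, h5]⟩
  simp only [Pi.neg_apply] at h
  rw [integral_neg] at h
  linarith

/-- On the sphere `ψ = 0` and `x·∇ψ` is a constant, nonzero by simplicity of the zero, so the
vanishing flux is a nonzero multiple of the integral of `u`. -/
theorem integral_sphere_eq_zero_of_helmholtz [Nontrivial E] {ν k R : ℝ} (hν : 0 ≤ ν) (hk : 0 < k)
    (hR : 0 < R) (hE : (Module.finrank ℝ E : ℝ) = 2 * ν + 2)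
    (h0 : besselEntire ν ((k * R) ^ 2) = 0) {u : E → ℝ} (hu : ContDiff ℝ 2 u)
    (hue : ∀ x, Δ u x + k ^ 2 * u x = 0) :
    ∫ θ : sphere (0 : E) 1, u (R • (θ : E)) ∂(volume : Measure E).toSphere = 0 := by
  have h := integral_sphere_wronskian_eq_zero (lam := -k ^ 2) hR hu
    (contDiff_infty.1 (contDiff_radialBessel (E := E) hν k) 2) (fun x => by linarith [hue x])
    (laplacian_radialBessel hν hE k)
  have hne := besselEntire_succ_ne_zero hν (mul_pos hk hR) h0
  set c : ℝ := k ^ 2 / 2 * besselEntire (ν + 1) ((k * R) ^ 2) * R ^ 2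
  have hc : c ≠ 0 := mul_ne_zero (mul_ne_zero (by positivity) hne) (by positivity)
  have hnorm : ∀ θ : sphere (0 : E) 1, ‖R • (θ : E)‖ = R := fun θ => by
    rw [norm_smul, Real.norm_of_nonneg hR.le, norm_eq_of_mem_sphere, mul_one]
  have e : ∀ θ : sphere (0 : E) 1,
      inner ℝ (radialBessel ν k (R • (θ : E)) • ∇ u (R • (θ : E)) -
        u (R • (θ : E)) • ∇ (radialBessel ν k) (R • (θ : E))) (R • (θ : E)) =
      c * u (R • (θ : E)) := fun θ => by
    rw [gradient_radialBessel hν, radialBessel, hnorm, ← mul_pow, h0, zero_smul, zero_sub,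
      inner_neg_left, inner_smul_left, inner_smul_left, real_inner_self_eq_norm_sq, hnorm]
    simp only [c, conj_trivial]
    ring
  simp only [e] at h
  rw [integral_const_mul] at h
  exact (mul_eq_zero.1 h).resolve_left hc

end Green

/-! ### Sign change, plane waves and Herglotz waves -/

section PlaneWave

variable {E : Type*} [NormedAddCommGroup E] [InnerProductSpace ℝ E] [FiniteDimensional ℝ E]
  [MeasurableSpace E] [BorelSpace E]

theorem eq_zero_on_sphere_of_nonneg {u : E → ℝ} {R : ℝ} (hR : 0 < R) (hu : Continuous u)
    (h0 : ∫ θ : sphere (0 : E) 1, u (R • (θ : E)) ∂(volume : Measure E).toSphere = 0)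
    (hpos : ∀ x ∈ sphere (0 : E) R, 0 ≤ u x) : ∀ x ∈ sphere (0 : E) R, u x = 0 := by
  have hmem : ∀ θ : sphere (0 : E) 1, R • (θ : E) ∈ sphere (0 : E) R := fun θ => by
    rw [mem_sphere_zero_iff_norm, norm_smul, Real.norm_of_nonneg hR.le, norm_eq_of_mem_sphere,
      mul_one]
  have hc : Continuous fun θ : sphere (0 : E) 1 => u (R • (θ : E)) := by fun_prop
  have hae := (integral_eq_zero_iff_of_nonneg (fun θ => hpos _ (hmem θ))
    (integrable_sphere_of_continuous hc)).1 h0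
  -- The surface measure charges every nonempty open set, so continuity upgrades almost everywhere
  -- to everywhere.
  have heq : (fun θ : sphere (0 : E) 1 => u (R • (θ : E))) = fun _ => 0 :=
    (hc.ae_eq_iff_eq (volume : Measure E).toSphere continuous_const).1 hae
  intro x hx
  have hx' : ‖x‖ = R := by simpa using hx
  have hθ : R⁻¹ • x ∈ sphere (0 : E) 1 := by
    rw [mem_sphere_zero_iff_norm, norm_smul, hx', Real.norm_of_nonneg (by positivity)]
    field_simp
  have h := congrFun heq ⟨R⁻¹ • x, hθ⟩
  simpa [smul_inv_smul₀ hR.ne'] using h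

theorem eq_zero_or_sign_change_on_sphere {u : E → ℝ} {R : ℝ} (hR : 0 < R) (hu : Continuous u)
    (h0 : ∫ θ : sphere (0 : E) 1, u (R • (θ : E)) ∂(volume : Measure E).toSphere = 0) :
    (∀ x ∈ sphere (0 : E) R, u x = 0) ∨
      ((∃ x ∈ sphere (0 : E) R, 0 < u x) ∧ ∃ y ∈ sphere (0 : E) R, u y < 0) := by
  by_cases hp : ∃ x ∈ sphere (0 : E) R, 0 < u x
  · by_cases hm : ∃ y ∈ sphere (0 : E) R, u y < 0
    · exact Or.inr ⟨hp, hm⟩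
    · push Not at hm
      exact Or.inl (eq_zero_on_sphere_of_nonneg hR hu h0 hm)
  · push Not at hp
    refine Or.inl fun x hx => ?_
    have h := eq_zero_on_sphere_of_nonneg (u := fun x => -u x) hR hu.neg
      (by rw [integral_neg, h0, neg_zero]) (fun y hy => by linarith [hp y hy]) x hx
    linarith

variable [Nontrivial E]

theorem integral_sphere_planeWave_eq_zero {ν k R : ℝ} (hν : 0 ≤ ν) (hk : 0 < k)
    (hR : 0 < R) (hE : (Module.finrank ℝ E : ℝ) = 2 * ν + 2)
    (h0 : besselEntire ν ((k * R) ^ 2) = 0) {z : E} (hz : ‖z‖ = 1) :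
    ∫ θ : sphere (0 : E) 1, Complex.exp (Complex.I * ((k * inner ℝ (R • (θ : E)) z : ℝ) : ℂ))
      ∂(volume : Measure E).toSphere = 0 := by
  have hl : ∀ t : ℝ, HasDerivAt (fun t : ℝ => k * t) k t := fun t => by
    simpa using (hasDerivAt_id t).const_mul k
  have hcos := integral_sphere_eq_zero_of_helmholtz hν hk hR hE h0
    (u := fun y : E => Real.cos (k * inner ℝ y z))
    (Real.contDiff_cos.comp (contDiff_const.mul (contDiff_id.inner ℝ contDiff_const))) fun x => by
      rw [laplacian_comp_inner (G := fun t => Real.cos (k * t))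
        (G' := fun t => -Real.sin (k * t) * k) (G'' := fun t => -(Real.cos (k * t) * k) * k)
        (Real.contDiff_cos.comp (contDiff_const.mul contDiff_id)) (fun t => (hl t).cos)
        (fun t => (hl t).sin.neg.mul_const k), hz]
      ring
  have hsin := integral_sphere_eq_zero_of_helmholtz hν hk hR hE h0
    (u := fun y : E => Real.sin (k * inner ℝ y z))
    (Real.contDiff_sin.comp (contDiff_const.mul (contDiff_id.inner ℝ contDiff_const))) fun x => by
      rw [laplacian_comp_inner (G := fun t => Real.sin (k * t))
        (G' := fun t => Real.cos (k * t) * k) (G'' := fun t => -Real.sin (k * t) * k * k)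
        (Real.contDiff_sin.comp (contDiff_const.mul contDiff_id)) (fun t => (hl t).sin)
        (fun t => (hl t).cos.mul_const k), hz]
      ring
  have e : ∀ t : ℝ, Complex.exp (Complex.I * (t : ℂ)) =
      ((Real.cos t : ℝ) : ℂ) + ((Real.sin t : ℝ) : ℂ) * Complex.I := fun t => by
    rw [mul_comm, Complex.exp_mul_I, Complex.ofReal_cos, Complex.ofReal_sin]
  simp only [e]
  rw [integral_add (integrable_sphere_of_continuous (by fun_prop))
    (integrable_sphere_of_continuous (by fun_prop)), integral_mul_const, integral_complex_ofReal,
    integral_complex_ofReal, hcos, hsin]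
  simp

/-- Fubini reduces the spherical mean of `u` to those of plane waves, which vanish. No
differentiation under the integral is involved, so continuity of `f` suffices, and positivity of the
real part already gives the contradiction. -/
theorem not_herglotz_pos_on_sphere {ν k R : ℝ} (hν : 0 ≤ ν) (hk : 0 < k)
    (hR : 0 < R) (hE : (Module.finrank ℝ E : ℝ) = 2 * ν + 2)
    (h0 : besselEntire ν ((k * R) ^ 2) = 0) {f u : E → ℂ} (hf : Continuous f)
    (hu : ∀ x, u x = ∫ z : sphere (0 : E) 1,
      Complex.exp (Complex.I * ((k * inner ℝ x (z : E) : ℝ) : ℂ)) * f z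
        ∂(volume : Measure E).toSphere) :
    ¬ ∀ x ∈ sphere (0 : E) R, 0 < (u x).re := by
  intro hpos
  set σ := (volume : Measure E).toSphere
  have hmem : ∀ θ : sphere (0 : E) 1, R • (θ : E) ∈ sphere (0 : E) R := fun θ => by
    rw [mem_sphere_zero_iff_norm, norm_smul, Real.norm_of_nonneg hR.le, norm_eq_of_mem_sphere,
      mul_one]
  set F : sphere (0 : E) 1 → sphere (0 : E) 1 → ℂ := fun θ z =>
    Complex.exp (Complex.I * ((k * inner ℝ (R • (θ : E)) (z : E) : ℝ) : ℂ)) * f z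
  have hF : Continuous (Function.uncurry F) := by
    simp only [F, Function.uncurry_def]
    fun_prop
  have hFi : Integrable (Function.uncurry F) (σ.prod σ) :=
    hF.integrable_of_hasCompactSupport (HasCompactSupport.of_compactSpace _)
  have huF : (fun θ : sphere (0 : E) 1 => u (R • (θ : E))) = fun θ => ∫ z, F θ z ∂σ :=
    funext fun θ => hu _
  have hui : Integrable (fun θ : sphere (0 : E) 1 => u (R • (θ : E))) σ := by
    rw [huF]
    exact hFi.integral_prod_left
  have hzero : ∫ θ : sphere (0 : E) 1, u (R • (θ : E)) ∂σ = 0 := by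
    rw [huF, integral_integral_swap hFi]
    simp only [F]
    simp_rw [integral_mul_const]
    refine integral_eq_zero_of_ae (Eventually.of_forall fun z => ?_)
    have hz := integral_sphere_planeWave_eq_zero hν hk hR hE h0 (norm_eq_of_mem_sphere z)
    simp only [Pi.zero_apply]
    rw [hz, zero_mul]
  have hre : ∫ θ : sphere (0 : E) 1, (u (R • (θ : E))).re ∂σ = 0 := by
    have := integral_re hui
    simp only [RCLike.re_to_complex] at this
    rw [this, hzero, Complex.zero_re]
  have hposint : 0 < ∫ θ : sphere (0 : E) 1, (u (R • (θ : E))).re ∂σ := by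
    refine (integral_pos_iff_support_of_nonneg (fun θ => (hpos _ (hmem θ)).le) hui.re).2 ?_
    have : Function.support (fun θ : sphere (0 : E) 1 => (u (R • (θ : E))).re) = Set.univ :=
      Set.eq_univ_of_forall fun θ => (hpos _ (hmem θ)).ne'
    rw [this]
    exact (ENNReal.toReal_pos_iff.1 toSphere_real_univ_pos).1
  exact hposint.ne' hre

end PlaneWave

/-! ### Assembly of the main theorem -/

theorem mainTheorem5 (n : ℕ) (hn : 2 ≤ n) (R : ℝ) (hR : 0 < R) :
    (∀ k : ℝ, 0 < k →
      ((∃ m : ℕ, 1 ≤ m ∧ k = besselJZero (((n : ℝ) - 2) / 2) m / R) ↔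
        ∃ w : EuclideanSpace ℝ (Fin n) → ℝ,
          IsDirichletEigenfunction (ball 0 R) (k ^ 2) w ∧ IsRadialOn (ball 0 R) w)) ∧
    (∀ m : ℕ, 1 ≤ m → ∀ k : ℝ, k = besselJZero (((n : ℝ) - 2) / 2) m / R →
      0 < k ∧
      (∀ u₀ : EuclideanSpace ℝ (Fin n) → ℝ, IsHelmholtzSolution k u₀ →
        (∀ x ∈ sphere (0 : EuclideanSpace ℝ (Fin n)) R, u₀ x = 0) ∨
        ((∃ x ∈ sphere (0 : EuclideanSpace ℝ (Fin n)) R, 0 < u₀ x) ∧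
          ∃ y ∈ sphere (0 : EuclideanSpace ℝ (Fin n)) R, u₀ y < 0)) ∧
      ¬ ∃ u₀ : EuclideanSpace ℝ (Fin n) → ℂ, IsHerglotzWave k u₀ ∧
        ∀ x ∈ sphere (0 : EuclideanSpace ℝ (Fin n)) R, (u₀ x).im = 0 ∧ 0 < (u₀ x).re) := by
  have : NeZero n := ⟨by omega⟩
  have hn' : (2 : ℝ) ≤ n := by exact_mod_cast hn
  have hE := finrank_eq_two_mul_add_two n
  have hν : 0 ≤ ((n : ℝ) - 2) / 2 := by linarith
  have hzero : ∀ m : ℕ, 1 ≤ m → 0 < besselJZero (((n : ℝ) - 2) / 2) m ∧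
      besselEntire (((n : ℝ) - 2) / 2) (besselJZero (((n : ℝ) - 2) / 2) m ^ 2) = 0 := fun m hm => by
    obtain ⟨m, rfl⟩ := Nat.exists_eq_succ_of_ne_zero (by omega : m ≠ 0)
    obtain ⟨h1, h2, h3⟩ := besselJZero_nonneg_and_succ_spec hν m
    exact ⟨h1.trans_lt h2, h3⟩
  refine ⟨fun k hk => ⟨?_, ?_⟩, ?_⟩
  · rintro ⟨m, hm, rfl⟩
    exact ⟨_, radialBessel_isDirichletEigenfunction hn hR
      (by rw [div_mul_cancel₀ _ hR.ne']; exact (hzero m hm).2)⟩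
  · rintro ⟨w, hw, hrad⟩
    obtain ⟨m, hm, h⟩ := exists_besselJZero_eq hν (mul_pos hk hR)
      (besselEntire_eq_zero_of_radial_eigenfunction hn hR hk hw hrad)
    exact ⟨m, hm, by rw [h, mul_div_cancel_right₀ _ hR.ne']⟩
  · rintro m hm k rfl
    have hk : 0 < besselJZero (((n : ℝ) - 2) / 2) m / R := div_pos (hzero m hm).1 hR
    have h0 : besselEntire (((n : ℝ) - 2) / 2)
        ((besselJZero (((n : ℝ) - 2) / 2) m / R * R) ^ 2) = 0 := by
      rw [div_mul_cancel₀ _ hR.ne']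
      exact (hzero m hm).2
    refine ⟨hk, fun u hu => eq_zero_or_sign_change_on_sphere hR hu.1.continuous
      (integral_sphere_eq_zero_of_helmholtz hν hk hR hE h0 hu.1 hu.2), ?_⟩
    rintro ⟨u, ⟨f, hf, huf⟩, hpos⟩
    exact not_herglotz_pos_on_sphere hν hk hR hE h0 hf.continuous huf fun x hx => (hpos x hx).2
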